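/- **Proposition 3.1 (localized estimates for the Hankel transform).** Let $n\ge 2$, let $(Y,h)$ be a closed (compact, without boundary) smooth Riemannian manifold of dimension $n-1$, let $\Delta_h$ be its positive Laplace–Beltrami operator, and let $V_0\in C^\infty(Y)$ be real-valued. Assume that the smallest eigenvalue of $\Delta_h+V_0+\frac{(n-2)^2}{4}$ is $\nu_0^2$ with $\nu_0>0$. Let $\Lambda_\infty$ be the set of all $\nu>0$ such that $\nu^2$ is an eigenvalue of this operator, and let $d(\nu)$ be the multiplicity of $\nu^2$. For $\nu\in\Lambda_\infty$ let $$J_\nu(x)=\frac{(x/2)^\nu}{\Gamma(\nu+\frac12)\Gamma(\frac12)}\int_{-1}^1e^{isx}(1-s^2)^{(2\nu-1)/2}\,ds\quad(x>0),\qquad (\mathcal H_\nu f)(r)=\int_0^\infty (r\rho)^{-\frac{n-2}{2}}J_\nu(r\rho)f(\rho)\rho^{n-1}\,d\rho$$ be the Bessel function and the Hankel transform of order $\nu$. There is a constant $C>0$, depending only on $n$, $(Y,h)$ and $V_0$, such that the following holds for every $\varphi\in C_c^\infty(\mathbb R)$ supported in $I:=[1,2]$, every family of measurable functions $b_{\nu,\ell}:(0,\infty)\to\mathbb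 C$ ($\nu\in\Lambda_\infty$, $1\le\ell\le d(\nu)$), each choice of the sign $\pm$, and every dyadic number $R=2^k$, $k\in\mathbb Z$. Put $S_R=[R/2,R]$ and $$G(t,r)=\Big(\sum_{\nu\in\Lambda_\infty}\sum_{\ell=1}^{d(\nu)}\Big|\mathcal H_\nu\big[\rho^{-1}e^{\pm it\rho}\varphi(\rho)b_{\nu,\ell}(\rho)\big](r)\Big|^2\Big)^{1/2}.$$ Then $$\|G\|_{L^2_tL^2_{r^{n-1}dr}(\mathbb R\times S_R)}\le C\min\{R^{\nu_0+1},R^{\frac12}\}\,\Big\|\Big(\sum_{\nu\in\Lambda_\infty}\sum_{\ell=1}^{d(\nu)}|b_{\nu,\ell}(\rho)\varphi(\rho)|^2\Big)^{1/2}\Big\|_{L^2_\rho(I)},$$ $$\|G\|_{L^\infty_tL^\infty_{r^{n-1}dr}(\mathbb R\times S_R)}\le C\min\{R^{\nu_0-\frac{n-2}2},R^{-\frac{n-2}2-\frac13}\}\,\Big\|\Big(\sum_{\nu\in\Lambda_\infty}\sum_{\ell=1}^{d(\nu)}|b_{\nu,\ell}(\rho)|^2\Big)^{1/2}\varphi(\rho)\Big\|_{L^1_\rho(I)},$$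 $$\|G\|_{L^\infty_tL^\infty_{r^{n-1}dr}(\mathbb R\times S_R)}\le C\min\{R^{\nu_0-\frac{n-2}2},R^{-\frac{n-1}2}\}\,\Big\|\Big(\sum_{\nu\in\Lambda_\infty}\sum_{\ell=1}^{d(\nu)}|b_{\nu,\ell}(\rho)|^2\Big)^{1/2}\varphi(\rho)\Big\|_{L^2_\rho(I)}.$$ (Each inequality is between elements of $[0,\infty]$ and is void when its right-hand side is infinite; when the right-hand side is finite, all the integrals defining $G$ converge absolutely.) -/

import Mathlib

open MeasureTheory Set Bundle Manifold
open scoped ContDiff ENNReal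

noncomputable section

/-! ### The operator `Δ_h + V₀ + (n-2)²/4` on the cross section

Throughout, `Y` is a Riemannian manifold of dimension `m`, without boundary, whose metric `h` is the
`RiemannianBundle` structure on the tangent spaces and whose distance is the Riemannian distance.
The potential is real, so the complex eigenspaces are the complexifications of the real ones, and
it suffices to work with real-valued functions. -/

/-- The Riemannian gradient `∇_h u (y)`: the tangent vector representing `du(y)` for the metric. -/
def riemannianGradient {m : ℕ} {Y : Type*} [TopologicalSpace Y]
    [ChartedSpace (EuclideanSpace ℝ (Fin m)) Y]
    [RiemannianBundle (fun y : Y => TangentSpace (𝓡 m) y)]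
    (u : Y → ℝ) (y : Y) : TangentSpace (𝓡 m) y :=
  haveI : FiniteDimensional ℝ (TangentSpace (𝓡 m) y) :=
    inferInstanceAs (FiniteDimensional ℝ (EuclideanSpace ℝ (Fin m)))
  haveI : CompleteSpace (TangentSpace (𝓡 m) y) := FiniteDimensional.complete ℝ _
  (InnerProductSpace.toDual ℝ (TangentSpace (𝓡 m) y)).symm (mfderiv (𝓡 m) 𝓘(ℝ, ℝ) u y)

/-- `Δ_h u = f`, where `Δ_h` is the positive Laplace-Beltrami operator. For smooth `u` and
continuous `f` on a closed manifold this is the identity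
`∫ f v dσ_h = ∫ h(∇u, ∇v) dσ_h` for every smooth `v`. The Riemannian volume `σ_h` is
the `m`-dimensional Hausdorff measure of the Riemannian distance, normalised so as to be Lebesgue
measure on `ℝ^m`. -/
def HasLaplaceBeltrami (m : ℕ) {Y : Type*} [EMetricSpace Y] [MeasurableSpace Y] [BorelSpace Y]
    [ChartedSpace (EuclideanSpace ℝ (Fin m)) Y]
    [RiemannianBundle (fun y : Y => TangentSpace (𝓡 m) y)]
    (u f : Y → ℝ) : Prop :=
  ∀ v : Y → ℝ, ContMDiff (𝓡 m) 𝓘(ℝ, ℝ) ∞ v →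
    ∫ y, f y * v y ∂(μHE[m] : Measure Y) =
      ∫ y, inner ℝ (riemannianGradient (m := m) u y) (riemannianGradient (m := m) v y)
        ∂(μHE[m] : Measure Y)

/-- The smooth solutions `u` on the cross section `Y`, of dimension `n - 1`, of
`(Δ_h + V₀ + (n-2)²/4) u = μ u`. -/
def coneEigenfunctions (n : ℕ) {Y : Type*} [EMetricSpace Y] [MeasurableSpace Y] [BorelSpace Y]
    [ChartedSpace (EuclideanSpace ℝ (Fin (n - 1))) Y]
    [RiemannianBundle (fun y : Y => TangentSpace (𝓡 (n - 1)) y)]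
    (V₀ : Y → ℝ) (μ : ℝ) : Set (Y → ℝ) :=
  {u | ContMDiff (𝓡 (n - 1)) 𝓘(ℝ, ℝ) ∞ u ∧
    HasLaplaceBeltrami (n - 1) u (fun y => (μ - V₀ y - ((n : ℝ) - 2) ^ 2 / 4) * u y)}

/-- The set of eigenvalues of `Δ_h + V₀ + (n-2)²/4`. -/
def coneEigenvalues (n : ℕ) {Y : Type*} [EMetricSpace Y] [MeasurableSpace Y] [BorelSpace Y]
    [ChartedSpace (EuclideanSpace ℝ (Fin (n - 1))) Y]
    [RiemannianBundle (fun y : Y => TangentSpace (𝓡 (n - 1)) y)]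
    (V₀ : Y → ℝ) : Set ℝ :=
  {μ | ∃ u ∈ coneEigenfunctions n V₀ μ, u ≠ 0}

/-- `Λ_∞`: the positive `ν` such that `ν²` is an eigenvalue of `Δ_h + V₀ + (n-2)²/4`. -/
def coneSpectrum (n : ℕ) {Y : Type*} [EMetricSpace Y] [MeasurableSpace Y] [BorelSpace Y]
    [ChartedSpace (EuclideanSpace ℝ (Fin (n - 1))) Y]
    [RiemannianBundle (fun y : Y => TangentSpace (𝓡 (n - 1)) y)]
    (V₀ : Y → ℝ) : Set ℝ :=
  {ν | 0 < ν ∧ ν ^ 2 ∈ coneEigenvalues n V₀}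

/-- `d(ν)`: the multiplicity of the eigenvalue `ν²`, the dimension of its eigenspace. -/
def coneMultiplicity (n : ℕ) {Y : Type*} [EMetricSpace Y] [MeasurableSpace Y] [BorelSpace Y]
    [ChartedSpace (EuclideanSpace ℝ (Fin (n - 1))) Y]
    [RiemannianBundle (fun y : Y => TangentSpace (𝓡 (n - 1)) y)]
    (V₀ : Y → ℝ) (ν : ℝ) : ℕ :=
  Module.finrank ℝ (Submodule.span ℝ (coneEigenfunctions n V₀ (ν ^ 2)))

/-! ### Bessel functions and the Hankel transform -/

/-- The Bessel function
`J_ν(r) = (r/2)^ν / (Γ(ν+1/2) Γ(1/2)) ∫_{-1}^1 e^{isr} (1-s²)^{(2ν-1)/2} ds`,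
for `ν > -1/2` and `r > 0`. -/
def besselJ (ν r : ℝ) : ℂ :=
  (((r / 2) ^ ν / (Real.Gamma (ν + 1 / 2) * Real.Gamma (1 / 2)) : ℝ) : ℂ) *
    ∫ s in (-1 : ℝ)..1,
      Complex.exp (Complex.I * s * r) * (((1 - s ^ 2) ^ ((2 * ν - 1) / 2) : ℝ) : ℂ)

/-- The Hankel transform of order `ν` in dimension `n`,
`(H_ν f)(r) = ∫_0^∞ (rρ)^{-(n-2)/2} J_ν(rρ) f(ρ) ρ^{n-1} dρ`. -/
def hankelTransform (n : ℕ) (ν : ℝ) (f : ℝ → ℂ) (r : ℝ) : ℂ :=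
  ∫ ρ in Ioi (0 : ℝ),
    (((r * ρ) ^ (-(((n : ℝ) - 2) / 2)) : ℝ) : ℂ) * besselJ ν (r * ρ) * f ρ *
      ((ρ ^ (n - 1) : ℝ) : ℂ)

/-! ### Square functions and norms -/

/-- `(∑_{ν ∈ Λ} ∑_{ℓ=1}^{d(ν)} |a_{ν,ℓ}|²)^{1/2}`, with value in `[0, ∞]`. -/
def squareSum {Λ : Set ℝ} {d : ℝ → ℕ} (a : (ν : Λ) → Fin (d ν) → ℂ) : ℝ≥0∞ :=
  (∑' ν : Λ, ∑' ℓ : Fin (d ν), ‖a ν ℓ‖ₑ ^ 2) ^ (1 / 2 : ℝ)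

/-- The measure `r^{n-1} dr` on `S_R = [R/2, R]`. -/
def shellMeasure (n : ℕ) (R : ℝ) : Measure ℝ :=
  (volume.restrict (Icc (R / 2) R)).withDensity (fun r => ENNReal.ofReal (r ^ (n - 1)))

/-- The square function over `(ν, ℓ)` of `H_ν[ρ^{-1} e^{iεtρ} φ(ρ) b_{ν,ℓ}(ρ)](r)`, at `(t, r)`;
the sign `ε` is `1` or `-1`. -/
def hankelSquareFunction (n : ℕ) {Λ : Set ℝ} {d : ℝ → ℕ} (ε : ℝ) (φ : ℝ → ℂ)
    (b : (ν : Λ) → Fin (d ν) → ℝ → ℂ) (z : ℝ × ℝ) : ℝ≥0∞ :=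
  squareSum (fun ν ℓ => hankelTransform n ν
    (fun ρ => (ρ : ℂ)⁻¹ * Complex.exp (Complex.I * ε * z.1 * ρ) * φ ρ * b ν ℓ ρ) z.2)

end

/-! The cross section enters only through `ν₀ ≤ ν` for every order, so everything reduces to
estimates of `J_ν` that are uniform in `ν ≥ ν₀ > 0`. Three of these are needed.

For small argument, Poisson's integral gives `|J_ν(x)| ≤ (x/2)^ν / Γ(ν+1)`, hence `O(x^{ν₀})` for `x
≤ 2`. For `x ≥ 1/2` Landau's bound `|J_ν(x)| ≤ C x^{-1/3}` holds. It is sharp only near the turning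
point `x ~ ν`, and in mean square the loss disappears: `∫_X^{2X} |J_ν|² ≤ C` for `X ≥ 1/2`. The last
two come from Schläfli's formula, which writes `J_ν(x)` as the real part of `π⁻¹ ∫_0^π e^{i(νt - x
sin t)} dt` minus a term bounded by `1/x`. Van der Corput's argument gives the pointwise bound. For
the mean square, the substitution `y = sin t` away from `t = π/2` makes the integral a Fourier
transform in `x` in which `ν` appears only in a unimodular factor, and Plancherel applies
(`lintegral_enorm_sq_besselJ_le`). Schläfli's formula is obtained by comparing power series, through
Hankel's loop integral for `1/Γ`.

At fixed `r` the Hankel transform is, as a function of `t`, the Fourier transform of a density on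
`[1,2]`. The `L²` estimate is Plancherel in `t`, Tonelli, and the mean square of `J_ν(rρ)` over `r`.
The `L¹ → L^∞` estimate is Landau's bound with Minkowski's inequality in `ℓ²`. The `L² → L^∞`
estimate is Cauchy–Schwarz in `ρ` and the mean square of `J_ν(rρ)` over `ρ`. For `R ≤ 1` the
small-argument bound replaces the other two. -/

/-! ### Oscillatory integrals with phase `ν t - x sin t` -/

/-- First-derivative test for oscillatory integrals with a convex phase. -/
theorem norm_integral_exp_le_of_le_abs_deriv {φ φ' φ'' : ℝ → ℝ} {a b l : ℝ} (hab : a ≤ b)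
    (hl : 0 < l) (h1 : ∀ t, HasDerivAt φ (φ' t) t) (h2 : ∀ t, HasDerivAt φ' (φ'' t) t)
    (h3 : Continuous φ'') (h4 : ∀ t ∈ Icc a b, 0 ≤ φ'' t) (h5 : ∀ t ∈ Icc a b, l ≤ |φ' t|) :
    ‖∫ t in a..b, Complex.exp (Complex.I * φ t)‖ ≤ 4 / l := by
  have hne : ∀ t ∈ Icc a b, φ' t ≠ 0 := fun t ht h => by
    have := h5 t ht
    rw [h, abs_zero] at this
    linarith
  have c1 : Continuous φ := continuous_iff_continuousAt.2 fun t => (h1 t).continuousAt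
  have c2 : Continuous φ' := continuous_iff_continuousAt.2 fun t => (h2 t).continuousAt
  have hu : ∀ t ∈ Icc a b,
      HasDerivAt (fun t => ((-(φ' t)⁻¹ : ℝ) : ℂ)) ((φ'' t / φ' t ^ 2 : ℝ) : ℂ) t := fun t ht => by
    have := ((h2 t).inv (hne t ht)).neg.ofReal_comp
    convert! this using 2
    ring
  have hv : ∀ t ∈ Icc a b, HasDerivAt (fun t => Complex.I * Complex.exp (Complex.I * φ t))
      (-(φ' t * Complex.exp (Complex.I * φ t))) t := fun t _ => by
    have := (((h1 t).ofReal_comp.const_mul Complex.I).cexp).const_mul Complex.I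
    convert! this using 1
    linear_combination (-Complex.exp (Complex.I * φ t) * φ' t) * Complex.I_mul_I
  have hcu : ContinuousOn (fun t => φ'' t / φ' t ^ 2) (Icc a b) :=
    h3.continuousOn.div (c2.continuousOn.pow 2) fun t ht => pow_ne_zero 2 (hne t ht)
  have iu : IntervalIntegrable (fun t => φ'' t / φ' t ^ 2) volume a b :=
    ContinuousOn.intervalIntegrable (by rwa [uIcc_of_le hab])
  have key := intervalIntegral.integral_mul_deriv_eq_deriv_mul
    (u := fun t => ((-(φ' t)⁻¹ : ℝ) : ℂ)) (v := fun t => Complex.I * Complex.exp (Complex.I * φ t))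
    (by rw [uIcc_of_le hab]; exact hu) (by rw [uIcc_of_le hab]; exact hv)
    (ContinuousOn.intervalIntegrable (by
      rw [uIcc_of_le hab]; exact Complex.continuous_ofReal.comp_continuousOn hcu)) (by apply Continuous.intervalIntegrable; fun_prop)
  have hL : (∫ t in a..b, Complex.exp (Complex.I * φ t)) =
      ∫ t in a..b, ((-(φ' t)⁻¹ : ℝ) : ℂ) * -(φ' t * Complex.exp (Complex.I * φ t)) := by
    apply intervalIntegral.integral_congr
    intro t ht
    rw [uIcc_of_le hab] at ht
    have : (φ' t : ℂ) ≠ 0 := by exact_mod_cast hne t ht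
    push_cast
    field_simp
  have hnv : ∀ t, ‖Complex.I * Complex.exp (Complex.I * φ t)‖ = 1 := fun t => by
    rw [norm_mul, Complex.norm_I, mul_comm Complex.I, Complex.norm_exp_ofReal_mul_I, one_mul]
  have hint : ∫ t in a..b, φ'' t / φ' t ^ 2 = -(φ' b)⁻¹ + (φ' a)⁻¹ := by
    rw [intervalIntegral.integral_eq_sub_of_hasDerivAt (f := fun t => -(φ' t)⁻¹) _ iu]
    · ring
    · intro t ht
      rw [uIcc_of_le hab] at ht
      have := ((h2 t).inv (hne t ht)).neg
      convert! this using 1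
      ring
  -- Convexity makes `φ''/φ'^2` equal to its absolute value, so its integral telescopes; with the
  -- boundary terms this costs `2/l + 2/l`.
  have hB : ‖∫ t in a..b, ((φ'' t / φ' t ^ 2 : ℝ) : ℂ) * (Complex.I * Complex.exp (Complex.I * φ t))‖
      ≤ -(φ' b)⁻¹ + (φ' a)⁻¹ := by
    rw [← hint]
    apply intervalIntegral.norm_integral_le_of_norm_le hab _ iu
    refine Filter.Eventually.of_forall fun t ht => ?_
    rw [norm_mul, hnv, mul_one, Complex.norm_real, Real.norm_eq_abs, abs_of_nonneg]
    exact div_nonneg (h4 t (Ioc_subset_Icc_self ht)) (sq_nonneg _)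
  have hbd : ∀ t ∈ Icc a b, |(φ' t)⁻¹| ≤ 1 / l := fun t ht => by
    rw [abs_inv, one_div]
    exact inv_anti₀ hl (h5 t ht)
  have ha := hbd a ⟨le_rfl, hab⟩
  have hb := hbd b ⟨hab, le_rfl⟩
  rw [hL, key]
  refine (norm_sub_le _ _).trans ?_
  have hx : ‖((-(φ' b)⁻¹ : ℝ) : ℂ) * (Complex.I * Complex.exp (Complex.I * φ b)) -
      ((-(φ' a)⁻¹ : ℝ) : ℂ) * (Complex.I * Complex.exp (Complex.I * φ a))‖ ≤ 1 / l + 1 / l := by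
    refine (norm_sub_le _ _).trans ?_
    rw [norm_mul ((-(φ' b)⁻¹ : ℝ) : ℂ), norm_mul ((-(φ' a)⁻¹ : ℝ) : ℂ), hnv, hnv, mul_one, mul_one, Complex.norm_real, Complex.norm_real,
      Real.norm_eq_abs, Real.norm_eq_abs, abs_neg, abs_neg]
    exact add_le_add hb ha
  have h6 := abs_le.1 ha
  have h7 := abs_le.1 hb
  have h8 : 4 / l = 4 * (1 / l) := by ring
  rw [h8]
  linarith [h6.2, h7.1]

theorem hasDerivAt_besselPhase (ν x t : ℝ) :
    HasDerivAt (fun t => ν * t - x * Real.sin t) (ν - x * Real.cos t) t := by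
  convert! ((hasDerivAt_id t).const_mul ν).sub ((Real.hasDerivAt_sin t).const_mul x) using 1
  ring

theorem hasDerivAt_besselPhase_deriv (ν x t : ℝ) :
    HasDerivAt (fun t => ν - x * Real.cos t) (x * Real.sin t) t := by
  convert! ((Real.hasDerivAt_cos t).const_mul x).const_sub ν using 1
  ring

theorem norm_integral_besselPhase_le_of_le_abs_deriv {ν x a b l : ℝ} (hx : 0 ≤ x) (hab : a ≤ b)
    (ha : 0 ≤ a) (hb : b ≤ Real.pi) (hl : 0 < l) (h : ∀ t ∈ Icc a b, l ≤ |ν - x * Real.cos t|) :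
    ‖∫ t in a..b, Complex.exp (Complex.I * (ν * t - x * Real.sin t : ℝ))‖ ≤ 4 / l :=
  norm_integral_exp_le_of_le_abs_deriv hab hl (hasDerivAt_besselPhase ν x)
    (hasDerivAt_besselPhase_deriv ν x) (by fun_prop)
    (fun t ht => mul_nonneg hx (Real.sin_nonneg_of_nonneg_of_le_pi (ha.trans ht.1) (ht.2.trans hb)))
    h

/-- The product formula `cos a - cos b = 2 sin((a+b)/2) sin((b-a)/2)` and Jordan's inequality for
the second factor. It bounds the phase derivative from below at distance `δ` from the stationary
point. -/
theorem mul_le_cos_sub_cos {a b K δ : ℝ} (hδ : 0 ≤ δ) (hab : δ ≤ b - a) (hb : b - a ≤ Real.pi)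
    (hK : 0 ≤ K) (h : K ≤ Real.sin ((a + b) / 2)) :
    2 / Real.pi * (K * δ) ≤ Real.cos a - Real.cos b := by
  rw [Real.cos_sub_cos]
  have h1 : 2 / Real.pi * ((b - a) / 2) ≤ Real.sin ((b - a) / 2) :=
    Real.mul_le_sin (by linarith) (by linarith)
  have h2 : 2 / Real.pi * (δ / 2) ≤ Real.sin ((b - a) / 2) := by
    refine le_trans ?_ h1
    have := Real.pi_pos
    gcongr
  have h3 : Real.sin ((a - b) / 2) = - Real.sin ((b - a) / 2) := by
    rw [← Real.sin_neg]; ring_nf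
  rw [h3]
  have h4 : 0 ≤ 2 / Real.pi * (δ / 2) := by have := Real.pi_pos; positivity
  have := mul_le_mul h h2 h4 (hK.trans h)
  linarith

/-- Van der Corput estimate for the phase `ν t - x sin t` around its stationary point. -/
theorem norm_integral_besselPhase_le {ν x p K δ : ℝ} (hx : 0 < x) (hp : p ∈ Icc 0 Real.pi)
    (hp' : ν = x * Real.cos p ∨ (p = 0 ∧ x ≤ ν))
    (hδ : 0 < δ) (hK : 0 < K)
    (h : ∀ t ∈ Icc 0 Real.pi, δ ≤ |t - p| → K ≤ Real.sin ((p + t) / 2)) :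
    ‖∫ t in 0..Real.pi, Complex.exp (Complex.I * (ν * t - x * Real.sin t : ℝ))‖ ≤
      2 * δ + 4 * Real.pi / (x * (K * δ)) := by
  have hπ := Real.pi_pos
  set l := x * (2 / Real.pi * (K * δ)) with hl
  have hlpos : 0 < l := by positivity
  have hform : 4 * Real.pi / (x * (K * δ)) = 4 / l + 4 / l := by
    rw [hl]; field_simp; norm_num
  set f : ℝ → ℂ := fun t => Complex.exp (Complex.I * (ν * t - x * Real.sin t : ℝ)) with hf
  have hfc : Continuous f := by fun_prop
  have hfi : ∀ a b, IntervalIntegrable f volume a b := fun a b => hfc.intervalIntegrable _ _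
  have hfn : ∀ t, ‖f t‖ ≤ 1 := fun t => by
    rw [hf]; simp only
    rw [mul_comm Complex.I, Complex.norm_exp_ofReal_mul_I]
  set c := max 0 (p - δ) with hc
  set d := min Real.pi (p + δ) with hd
  have hcp : c ≤ p := max_le hp.1 (by linarith)
  have hpd : p ≤ d := le_min hp.2 (by linarith)
  have hc0 : 0 ≤ c := le_max_left _ _
  have hdπ : d ≤ Real.pi := min_le_left _ _
  have hdc : d - c ≤ 2 * δ := by
    have := le_max_right 0 (p - δ)
    have := min_le_right Real.pi (p + δ)
    linarith
  have e1 : ‖∫ t in 0..c, f t‖ ≤ 4 / l := by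
    rcases le_or_gt (p - δ) 0 with h0 | h0
    · have : c = 0 := max_eq_left h0
      rw [this, intervalIntegral.integral_same, norm_zero]; positivity
    · have hcc : c = p - δ := max_eq_right h0.le
      -- A nonempty left interval forces `p > δ > 0`, which excludes the case without a genuine
      -- stationary point.
      have hν : ν = x * Real.cos p := by
        rcases hp' with h | h
        · exact h
        · linarith [h.1]
      refine norm_integral_besselPhase_le_of_le_abs_deriv hx.le hc0 le_rfl
        (hcp.trans hp.2) hlpos fun t ht => ?_
      have ht2 : t ≤ p - δ := hcc ▸ ht.2
      have := mul_le_cos_sub_cos (a := t) (b := p) hδ.le (by linarith) (by linarith [hp.2, ht.1]) hK.le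
        (by rw [add_comm]; exact h t ⟨ht.1, by linarith [hp.2]⟩
              (by rw [abs_sub_comm]; exact le_trans (by linarith) (le_abs_self _)))
      rw [hν, ← mul_sub, abs_mul, abs_of_pos hx, abs_sub_comm]
      exact mul_le_mul_of_nonneg_left (this.trans (le_abs_self _)) hx.le
  have e2 : ‖∫ t in d..Real.pi, f t‖ ≤ 4 / l := by
    rcases le_or_gt Real.pi (p + δ) with h0 | h0
    · have : d = Real.pi := min_eq_left h0
      rw [this, intervalIntegral.integral_same, norm_zero]; positivity
    · have hdd : d = p + δ := min_eq_right h0.le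
      have hν : x * Real.cos p ≤ ν := by
        rcases hp' with h | h
        · exact h.ge
        · rw [h.1, Real.cos_zero]; linarith [h.2]
      refine norm_integral_besselPhase_le_of_le_abs_deriv hx.le hdπ (hc0.trans (hcp.trans hpd))
        le_rfl hlpos fun t ht => ?_
      have ht2 : p + δ ≤ t := hdd ▸ ht.1
      have := mul_le_cos_sub_cos (a := p) (b := t) hδ.le (by linarith) (by linarith [hp.1, ht.2]) hK.le
        (h t ⟨by linarith [hp.1], ht.2⟩ (le_trans (by linarith) (le_abs_self _)))
      refine le_trans ?_ (le_abs_self _)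
      have := mul_le_mul_of_nonneg_left this hx.le
      linarith
  have e3 : ‖∫ t in c..d, f t‖ ≤ 2 * δ := by
    refine (intervalIntegral.norm_integral_le_of_norm_le_const fun t _ => hfn t).trans ?_
    rw [one_mul, abs_of_nonneg (by linarith)]
    exact hdc
  have hsplit : ∫ t in 0..Real.pi, f t =
      (∫ t in 0..c, f t) + (∫ t in c..d, f t) + ∫ t in d..Real.pi, f t := by
    rw [intervalIntegral.integral_add_adjacent_intervals (hfi _ _) (hfi _ _),
      intervalIntegral.integral_add_adjacent_intervals (hfi _ _) (hfi _ _)]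
  rw [hsplit, hform]
  refine (norm_add₃_le).trans ?_
  linarith

/-- `Real.arccos` is `0` at arguments at least `1`, so the same formula gives the stationary point
when `ν ≤ x` and the minimum of the phase derivative when `ν > x`. -/
theorem exists_stationary_besselPhase {ν x : ℝ} (hν : 0 ≤ ν) (hx : 0 < x) :
    ν = x * Real.cos (Real.arccos (ν / x)) ∨ (Real.arccos (ν / x) = 0 ∧ x ≤ ν) := by
  rcases le_or_gt (ν / x) 1 with h | h
  · left
    rw [Real.cos_arccos (by have := div_nonneg hν hx.le; linarith) h]
    field_simp
  · right
    exact ⟨Real.arccos_eq_zero.2 h.le, by rw [lt_div_iff₀ hx] at h; linarith⟩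

/-- If `|t - p| ≥ δ`, the midpoint of `t` and `p` stays `δ/2` away from `0` and `π`, so its sine is
at least `δ/π`. The choice `δ = x^{-1/3}` balances `δ` against `1/(x δ²)`. -/
theorem norm_integral_besselPhase_le_rpow_third {ν x : ℝ} (hν : 0 ≤ ν) (hx : 1 / 2 ≤ x) :
    ‖∫ t in 0..Real.pi, Complex.exp (Complex.I * (ν * t - x * Real.sin t : ℝ))‖ ≤
      60 * x ^ (-(1 / 3) : ℝ) := by
  have hx0 : 0 < x := by linarith
  have hπ := Real.pi_pos
  set δ := x ^ (-(1 / 3) : ℝ) with hδ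
  have hδ0 : 0 < δ := by positivity
  have hδ3 : x * (δ * δ) = δ⁻¹ := by
    rw [hδ, ← Real.rpow_neg hx0.le, ← Real.rpow_add hx0]
    nth_rewrite 1 [← Real.rpow_one x]
    rw [← Real.rpow_add hx0]
    norm_num
  have := norm_integral_besselPhase_le (ν := ν) (x := x) (p := Real.arccos (ν / x))
    (K := δ / Real.pi) (δ := δ) hx0
    ⟨Real.arccos_nonneg _, Real.arccos_le_pi _⟩ (exists_stationary_besselPhase hν hx0) hδ0
    (by positivity) (by
      intro t ht h
      set p := Real.arccos (ν / x)
      have hp0 : 0 ≤ p := Real.arccos_nonneg _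
      have hp1 : p ≤ Real.pi := Real.arccos_le_pi _
      have key : ∀ m : ℝ, δ / 2 ≤ m → m ≤ Real.pi - δ / 2 → δ / Real.pi ≤ Real.sin m := by
        intro m h1 h2
        have e : δ / Real.pi = 2 / Real.pi * (δ / 2) := by field_simp
        rw [e]
        rcases le_total m (Real.pi / 2) with h3 | h3
        · refine le_trans ?_ (Real.mul_le_sin (by linarith) h3)
          gcongr
        · rw [← Real.sin_pi_sub]
          refine le_trans ?_ (Real.mul_le_sin (by linarith) (by linarith))
          gcongr
          linarith
      apply key
      · rcases le_abs.1 h with h | h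
        · linarith
        · linarith [ht.1]
      · rcases le_abs.1 h with h | h
        · linarith [ht.2]
        · linarith)
  refine this.trans ?_
  have e : 4 * Real.pi / (x * (δ / Real.pi * δ)) = 4 * Real.pi ^ 2 * δ := by
    have : x * (δ / Real.pi * δ) = δ⁻¹ / Real.pi := by rw [← hδ3]; ring
    rw [this]; field_simp
  rw [e]
  have hp2 : Real.pi ^ 2 < 14 := by
    have := Real.pi_lt_d2
    nlinarith
  nlinarith

/-- For `ν ≤ x/2` the stationary point lies in `[π/3, π/2]`, where it is nondegenerate: the midpoint
stays in `[π/6, 3π/4]` and `K` is a constant. Balancing `δ` with `1/(x δ)` gives `δ = x^{-1/2}`. -/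
theorem norm_integral_besselPhase_le_rpow_half {ν x : ℝ} (hν : 0 ≤ ν) (hx : 1 / 2 ≤ x)
    (hνx : 2 * ν ≤ x) :
    ‖∫ t in 0..Real.pi, Complex.exp (Complex.I * (ν * t - x * Real.sin t : ℝ))‖ ≤
      60 * x ^ (-(1 / 2) : ℝ) := by
  have hx0 : 0 < x := by linarith
  have hπ := Real.pi_pos
  set δ := x ^ (-(1 / 2) : ℝ) with hδ
  have hδ0 : 0 < δ := by positivity
  have hδ2 : x * δ = δ⁻¹ := by
    rw [hδ, ← Real.rpow_neg hx0.le]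
    nth_rewrite 1 [← Real.rpow_one x]
    rw [← Real.rpow_add hx0]
    norm_num
  have h1 : Real.pi / 3 ≤ Real.arccos (ν / x) := by
    rw [← Real.arccos_cos (x := Real.pi / 3) (by linarith) (by linarith), Real.cos_pi_div_three]
    apply Real.arccos_le_arccos
    rw [div_le_div_iff₀ hx0 two_pos]
    linarith
  have h2 : Real.arccos (ν / x) ≤ Real.pi / 2 := Real.arccos_le_pi_div_two.2 (by positivity)
  have := norm_integral_besselPhase_le (ν := ν) (x := x) (p := Real.arccos (ν / x))
    (K := 1 / 3) (δ := δ) hx0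
    ⟨Real.arccos_nonneg _, Real.arccos_le_pi _⟩ (exists_stationary_besselPhase hν hx0) hδ0
    (by positivity) (by
      intro t ht h
      set p := Real.arccos (ν / x)
      have key : ∀ m : ℝ, Real.pi / 6 ≤ m → m ≤ 3 * Real.pi / 4 → 1 / 3 ≤ Real.sin m := by
        intro m h1 h2
        have e : (1 : ℝ) / 3 = 2 / Real.pi * (Real.pi / 6) := by field_simp; norm_num
        rw [e]
        rcases le_total m (Real.pi / 2) with h3 | h3
        · refine le_trans ?_ (Real.mul_le_sin (by linarith) h3)
          gcongr
        · rw [← Real.sin_pi_sub]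
          refine le_trans ?_ (Real.mul_le_sin (by linarith) (by linarith))
          gcongr
          linarith
      apply key
      · linarith [ht.1]
      · linarith [ht.2])
  refine this.trans ?_
  have e : 4 * Real.pi / (x * (1 / 3 * δ)) = 12 * Real.pi * δ := by
    have : x * (1 / 3 * δ) = δ⁻¹ / 3 := by rw [← hδ2]; ring
    rw [this]; field_simp
    norm_num
  rw [e]
  have hp2 := Real.pi_lt_d2
  nlinarith

/-! ### Hankel's loop integral for the reciprocal Gamma function -/

theorem exp_neg_mul_exp_le {a : ℝ} (ha : 0 < a) (μ : ℝ) {t : ℝ} (ht : 0 ≤ t) :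
    Real.exp (-a * Real.exp t - μ * t) ≤ Real.exp ((1 - μ) ^ 2 / (2 * a)) * Real.exp (-t) := by
  rw [← Real.exp_add]
  apply Real.exp_le_exp.2
  have h1 : t ^ 2 / 2 ≤ Real.exp t := by
    have := Real.quadratic_le_exp_of_nonneg ht
    linarith
  have h2 : (1 - μ) * t - a * (t ^ 2 / 2) ≤ (1 - μ) ^ 2 / (2 * a) := by
    rw [le_div_iff₀ (by positivity)]
    nlinarith [sq_nonneg (a * t - (1 - μ))]
  have h3 := mul_le_mul_of_nonneg_left h1 ha.le
  linarith

theorem integrableOn_exp_neg_mul_exp {a : ℝ} (ha : 0 < a) (μ : ℝ) :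
    IntegrableOn (fun t => Real.exp (-a * Real.exp t - μ * t)) (Ioi 0) := by
  refine Integrable.mono' ((integrableOn_exp_neg_Ioi 0).const_mul
    (Real.exp ((1 - μ) ^ 2 / (2 * a)))) (by fun_prop) ?_
  refine (ae_restrict_mem measurableSet_Ioi).mono fun t ht => ?_
  rw [Real.norm_eq_abs, abs_of_pos (Real.exp_pos _)]
  exact exp_neg_mul_exp_le ha μ (le_of_lt ht)

theorem integrableOn_exp_neg_mul_exp_Iic {a μ : ℝ} (ha : 0 < a) (hμ : μ < 0) :
    IntegrableOn (fun t => Real.exp (-a * Real.exp t - μ * t)) (Iic 0) := by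
  refine Integrable.mono' (integrableOn_exp_mul_Iic (a := -μ) (by linarith) 0) (by fun_prop) ?_
  refine Filter.Eventually.of_forall fun t => ?_
  rw [Real.norm_eq_abs, abs_of_pos (Real.exp_pos _)]
  apply Real.exp_le_exp.2
  have := mul_pos ha (Real.exp_pos t)
  linarith

theorem integral_exp_neg_mul_exp {a μ : ℝ} (ha : 0 < a) (hμ : μ < 0) :
    ∫ t, Real.exp (-a * Real.exp t - μ * t) = a ^ μ * Real.Gamma (-μ) := by
  have h := integral_image_eq_integral_abs_deriv_smul (s := univ) (f := Real.exp) (f' := Real.exp)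
    MeasurableSet.univ (fun x _ => (Real.hasDerivAt_exp x).hasDerivWithinAt)
    (Real.exp_injective.injOn) (fun u => u ^ (-μ - 1) * Real.exp (-(a * u)))
  rw [image_univ, Real.range_exp, Measure.restrict_univ,
    Real.integral_rpow_mul_exp_neg_mul_Ioi (by linarith) ha] at h
  have e : (1 / a) ^ (-μ) = a ^ μ := by
    rw [one_div, Real.inv_rpow ha.le, ← Real.rpow_neg ha.le, neg_neg]
  rw [← e, h]
  congr 1
  ext t
  rw [abs_of_pos (Real.exp_pos t), smul_eq_mul, ← Real.exp_mul, ← Real.exp_add, ← Real.exp_add]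
  congr 1
  ring

/-- The integral of `exp (a e^w - μ w) / (2πi)` along the Hankel contour in logarithmic coordinates:
the segment `[-iπ, iπ]` together with the rays `[0, ∞) ± iπ`. -/
noncomputable def hankelContour (a μ : ℝ) : ℂ :=
  (2 * Real.pi : ℂ)⁻¹ * (∫ y in (-Real.pi)..Real.pi,
      Complex.exp (a * Complex.exp (y * Complex.I) - μ * (y * Complex.I))) -
    ((Real.sin (μ * Real.pi) / Real.pi *
      ∫ t in Ioi (0 : ℝ), Real.exp (-a * Real.exp t - μ * t) : ℝ) : ℂ)

theorem exp_add_pi_mul_I (x : ℝ) : Complex.exp (x + Real.pi * Complex.I) = -(Real.exp x : ℂ) := by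
  rw [Complex.exp_add, Complex.exp_pi_mul_I, Complex.ofReal_exp]; ring

theorem exp_sub_pi_mul_I (x : ℝ) : Complex.exp (x + (-Real.pi : ℝ) * Complex.I) =
    -(Real.exp x : ℂ) := by
  rw [Complex.exp_add, Complex.ofReal_neg, neg_mul, Complex.exp_neg, Complex.exp_pi_mul_I,
    Complex.ofReal_exp]; norm_num

theorem exp_sub_exp_eq_sin (θ : ℝ) : Complex.exp (θ * Complex.I) - Complex.exp (-(θ * Complex.I)) =
    2 * Complex.I * (Real.sin θ : ℂ) := by
  rw [← neg_mul, Complex.exp_mul_I, Complex.exp_mul_I, Complex.cos_neg, Complex.sin_neg,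
    Complex.ofReal_sin]; ring

/-- Cauchy's theorem on the rectangle `[A, 0] × [-π, π]` as `A → -∞`. The left side is `O(e^{-μA})`,
which vanishes because `μ < 0`. On the horizontal sides the integrands are one real function times
`e^{±iμπ}`, hence the sine. -/
theorem integral_segment_eq_of_neg {a μ : ℝ} (ha : 0 < a) (hμ : μ < 0) :
    ∫ y in (-Real.pi)..Real.pi,
      Complex.exp (a * Complex.exp (y * Complex.I) - μ * (y * Complex.I)) =
    ((-(2 * Real.sin (μ * Real.pi) *
      ∫ t in Iic (0 : ℝ), Real.exp (-a * Real.exp t - μ * t)) : ℝ) : ℂ) := by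
  set f : ℂ → ℂ := fun w => Complex.exp (a * Complex.exp w - μ * w) with hf
  have hfd : Differentiable ℂ f := by fun_prop
  have hrect : ∀ A : ℝ, (∫ y in (-Real.pi)..Real.pi, f (y * Complex.I)) =
      (∫ y in (-Real.pi)..Real.pi, f (A + y * Complex.I)) +
      ((-(2 * Real.sin (μ * Real.pi) *
        ∫ t in A..0, Real.exp (-a * Real.exp t - μ * t)) : ℝ) : ℂ) := by
    intro A
    have h := Complex.integral_boundary_rect_eq_zero_of_differentiableOn f
      (⟨A, -Real.pi⟩ : ℂ) (⟨0, Real.pi⟩ : ℂ) hfd.differentiableOn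
    simp only [smul_eq_mul, Complex.ofReal_zero, zero_add] at h
    have h1 : ∀ x : ℝ, f (x + (-Real.pi : ℝ) * Complex.I) =
        Complex.exp ((μ * Real.pi : ℝ) * Complex.I) * (Real.exp (-a * Real.exp x - μ * x) : ℂ) := by
      intro x
      simp only [hf]
      rw [exp_sub_pi_mul_I, Complex.ofReal_exp (-a * Real.exp x - μ * x), ← Complex.exp_add]
      congr 1; push_cast; ring
    have h2 : ∀ x : ℝ, f (x + Real.pi * Complex.I) =
        Complex.exp (-((μ * Real.pi : ℝ) * Complex.I)) *
          (Real.exp (-a * Real.exp x - μ * x) : ℂ) := by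
      intro x
      simp only [hf]
      rw [exp_add_pi_mul_I, Complex.ofReal_exp (-a * Real.exp x - μ * x), ← Complex.exp_add]
      congr 1; push_cast; ring
    simp only [h1, h2] at h
    rw [intervalIntegral.integral_const_mul, intervalIntegral.integral_const_mul,
      intervalIntegral.integral_ofReal, ← sub_mul, exp_sub_exp_eq_sin] at h
    have hI := Complex.I_mul_I
    push_cast at h ⊢
    linear_combination (-Complex.I) * h + (∫ y in (-Real.pi)..Real.pi, f (y * Complex.I)) * hI
      - (∫ y in (-Real.pi)..Real.pi, f (A + y * Complex.I)) * hI
      + (2 * Complex.sin (μ * Real.pi) *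
        ((∫ t in A..0, Real.exp (-a * Real.exp t - μ * t) : ℝ) : ℂ)) * hI
  have hlim1 : Filter.Tendsto (fun A : ℝ => ∫ y in (-Real.pi)..Real.pi, f (A + y * Complex.I))
      Filter.atBot (nhds 0) := by
    have hb : ∀ A : ℝ, A ≤ 0 → ‖∫ y in (-Real.pi)..Real.pi, f (A + y * Complex.I)‖ ≤
        Real.exp (a - μ * A) * |Real.pi - -Real.pi| := by
      intro A hA
      refine intervalIntegral.norm_integral_le_of_norm_le_const fun y _ => ?_
      rw [hf, Complex.norm_exp]
      apply Real.exp_le_exp.2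
      have e1 : (a * Complex.exp (A + y * Complex.I) - μ * (A + y * Complex.I)).re =
          a * (Complex.exp (A + y * Complex.I)).re - μ * A := by simp
      rw [e1]
      have e2 : (Complex.exp (A + y * Complex.I)).re ≤ 1 := by
        refine (Complex.re_le_norm _).trans ?_
        rw [Complex.norm_exp]
        simpa using hA
      nlinarith
    refine squeeze_zero_norm' ((Filter.eventually_le_atBot 0).mono hb) ?_
    rw [← zero_mul (|Real.pi - -Real.pi|)]
    apply Filter.Tendsto.mul_const
    apply Real.tendsto_exp_atBot.comp
    simp only [sub_eq_add_neg]
    apply Filter.tendsto_atBot_add_const_left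
    simp only [← neg_mul]
    exact Filter.tendsto_id.const_mul_atBot (by linarith)
  have hlim2 : Filter.Tendsto (fun A : ℝ => ((-(2 * Real.sin (μ * Real.pi) *
        ∫ t in A..0, Real.exp (-a * Real.exp t - μ * t)) : ℝ) : ℂ)) Filter.atBot
      (nhds ((-(2 * Real.sin (μ * Real.pi) *
        ∫ t in Iic (0 : ℝ), Real.exp (-a * Real.exp t - μ * t)) : ℝ) : ℂ)) := by
    refine (Complex.continuous_ofReal.tendsto _).comp ?_
    exact (intervalIntegral_tendsto_integral_Iic 0 (integrableOn_exp_neg_mul_exp_Iic ha hμ)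
      Filter.tendsto_id).const_mul _ |>.neg
  have := hlim1.add hlim2
  simp only [← hrect, zero_add] at this
  exact tendsto_nhds_unique tendsto_const_nhds this

/-- The half-line integrals join into `∫_ℝ exp(-a e^t - μ t) dt = a^μ Γ(-μ)`, and the reflection
formula turns this into `1/Γ(μ+1)`. -/
theorem hankelContour_of_neg {a μ : ℝ} (ha : 0 < a) (hμ : μ < 0) :
    hankelContour a μ = ((a ^ μ / Real.Gamma (μ + 1) : ℝ) : ℂ) := by
  have hπ := Real.pi_pos
  have h1 : (∫ t in Iic (0 : ℝ), Real.exp (-a * Real.exp t - μ * t)) +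
      ∫ t in Ioi (0 : ℝ), Real.exp (-a * Real.exp t - μ * t) = a ^ μ * Real.Gamma (-μ) := by
    rw [intervalIntegral.integral_Iic_add_Ioi (integrableOn_exp_neg_mul_exp_Iic ha hμ)
      (integrableOn_exp_neg_mul_exp ha μ), integral_exp_neg_mul_exp ha hμ]
  have h2 : -(Real.sin (μ * Real.pi) / Real.pi) * Real.Gamma (-μ) = (Real.Gamma (μ + 1))⁻¹ := by
    have h3 := Real.Gamma_mul_Gamma_one_sub (-μ)
    have h4 : Real.sin (Real.pi * -μ) = - Real.sin (μ * Real.pi) := by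
      rw [← Real.sin_neg]; ring_nf
    rw [h4, show 1 - -μ = μ + 1 by ring] at h3
    have hg : Real.Gamma (-μ) ≠ 0 := (Real.Gamma_pos_of_pos (by linarith)).ne'
    -- At a negative integer `μ`, `Real.Gamma (μ + 1)` is `0` by convention, and so is its inverse;
    -- both sides vanish.
    by_cases hs : Real.sin (μ * Real.pi) = 0
    · rw [hs, neg_zero, div_zero] at h3
      have h5 : Real.Gamma (μ + 1) = 0 := by simpa [hg] using h3
      rw [hs, h5]; simp
    · have h5 : Real.Gamma (μ + 1) ≠ 0 := by
        intro h
        rw [h, mul_zero, eq_comm, div_eq_zero_iff] at h3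
        rcases h3 with h3 | h3
        · exact hπ.ne' h3
        · exact hs (by linarith)
      apply eq_inv_of_mul_eq_one_left
      rw [mul_assoc, h3]
      field_simp
  rw [hankelContour, integral_segment_eq_of_neg ha hμ]
  norm_cast
  rw [div_eq_mul_inv (a ^ μ), ← h2, eq_comm]
  calc a ^ μ * (-(Real.sin (μ * Real.pi) / Real.pi) * Real.Gamma (-μ))
      = -(Real.sin (μ * Real.pi) / Real.pi) * (a ^ μ * Real.Gamma (-μ)) := by ring
    _ = _ := by rw [← h1]; field_simp; ring

/-- The mean value property of `e^{az}` on the unit circle. Order zero needs its own argument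
because the recurrence determines nothing there. -/
theorem hankelContour_zero (a : ℝ) : hankelContour a 0 = 1 := by
  have hπ : (Real.pi : ℂ) ≠ 0 := by exact_mod_cast Real.pi_pos.ne'
  have h1 := DiffContOnCl.circleAverage (f := fun z : ℂ => Complex.exp (a * z)) (c := 0) (R := 1)
    (Differentiable.diffContOnCl (by fun_prop))
  rw [Real.circleAverage] at h1
  have hper : Function.Periodic (fun θ : ℝ => Complex.exp (a * circleMap 0 1 θ)) (2 * Real.pi) :=
    fun θ => by simp only; rw [periodic_circleMap]
  have h2 := hper.intervalIntegral_add_eq 0 (-Real.pi)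
  rw [zero_add, show -Real.pi + 2 * Real.pi = Real.pi by ring] at h2
  rw [h2] at h1
  rw [hankelContour]
  simp only [zero_mul, Complex.ofReal_zero, sub_zero, Real.sin_zero, zero_div]
  simp [circleMap] at h1
  rw [← h1]
  simp

/-- The derivative of `exp(a e^w - μ w)` integrates to zero along the contour: the end values at
`±iπ` cancel between segment and rays, and the function decays at infinity. -/
theorem hankelContour_recurrence {a : ℝ} (ha : 0 < a) (μ : ℝ) :
    a * hankelContour a (μ - 1) = μ * hankelContour a μ := by
  have hπ : (Real.pi : ℂ) ≠ 0 := by exact_mod_cast Real.pi_pos.ne'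
  set F : ℝ → ℝ → ℂ := fun μ y =>
    Complex.exp (a * Complex.exp (y * Complex.I) - μ * (y * Complex.I)) with hF
  have hseg : a * (∫ y in (-Real.pi)..Real.pi, F (μ - 1) y) - μ * ∫ y in (-Real.pi)..Real.pi, F μ y
      = ((-2 * Real.sin (μ * Real.pi) * Real.exp (-a) : ℝ) : ℂ) := by
    have hd : ∀ y ∈ uIcc (-Real.pi) Real.pi,
        HasDerivAt (F μ) (Complex.I * (a * F (μ - 1) y - μ * F μ y)) y := by
      intro y _
      have h0 : HasDerivAt (fun y : ℝ => (y : ℂ) * Complex.I) Complex.I y := by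
        simpa using (Complex.ofRealCLM.hasDerivAt (x := y)).mul_const Complex.I
      have h1 := ((h0.cexp.const_mul (a : ℂ)).sub (h0.const_mul (μ : ℂ))).cexp
      convert! h1 using 1
      have e : F (μ - 1) y = F μ y * Complex.exp (y * Complex.I) := by
        simp only [hF]
        rw [← Complex.exp_add]
        congr 1; push_cast; ring
      rw [e]
      simp only [hF, Pi.sub_apply]
      ring
    have h2 := intervalIntegral.integral_eq_sub_of_hasDerivAt hd
      (by apply Continuous.intervalIntegrable; fun_prop)
    rw [intervalIntegral.integral_const_mul, intervalIntegral.integral_sub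
      (by apply Continuous.intervalIntegrable; fun_prop)
      (by apply Continuous.intervalIntegrable; fun_prop),
      intervalIntegral.integral_const_mul, intervalIntegral.integral_const_mul] at h2
    have h3 : F μ Real.pi = (Real.exp (-a) : ℂ) * Complex.exp (-((μ * Real.pi : ℝ) * Complex.I)) := by
      simp only [hF]
      rw [Complex.exp_pi_mul_I, Complex.ofReal_exp, ← Complex.exp_add]
      congr 1; push_cast; ring
    have h4 : F μ (-Real.pi) = (Real.exp (-a) : ℂ) * Complex.exp ((μ * Real.pi : ℝ) * Complex.I) := by
      simp only [hF]
      have := exp_sub_pi_mul_I 0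
      rw [Complex.ofReal_zero, zero_add, Real.exp_zero] at this
      rw [this, Complex.ofReal_exp, ← Complex.exp_add]
      congr 1; push_cast; ring
    rw [h3, h4, ← mul_sub, ← neg_sub (Complex.exp _) (Complex.exp _), exp_sub_exp_eq_sin] at h2
    push_cast at h2 ⊢
    apply mul_left_cancel₀ Complex.I_ne_zero
    rw [h2]; ring
  have hray : a * (∫ t in Ioi (0 : ℝ), Real.exp (-a * Real.exp t - (μ - 1) * t)) +
      μ * ∫ t in Ioi (0 : ℝ), Real.exp (-a * Real.exp t - μ * t) = Real.exp (-a) := by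
    have hd : ∀ t ∈ Ici (0 : ℝ), HasDerivAt (fun t => -Real.exp (-a * Real.exp t - μ * t))
        (a * Real.exp (-a * Real.exp t - (μ - 1) * t) + μ * Real.exp (-a * Real.exp t - μ * t)) t := by
      intro t _
      have h1 := ((((Real.hasDerivAt_exp t).const_mul (-a)).sub
        ((hasDerivAt_id t).const_mul μ)).exp).neg
      convert! h1 using 1
      have e : Real.exp (-a * Real.exp t - (μ - 1) * t) =
          Real.exp (-a * Real.exp t - μ * t) * Real.exp t := by
        rw [← Real.exp_add]; congr 1; ring
      rw [e]
      simp only [Pi.sub_apply, id]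
      ring
    have hi1 := (integrableOn_exp_neg_mul_exp ha (μ - 1)).const_mul a
    have hi2 := (integrableOn_exp_neg_mul_exp ha μ).const_mul μ
    have hlim : Filter.Tendsto (fun t => -Real.exp (-a * Real.exp t - μ * t)) Filter.atTop
        (nhds 0) := by
      rw [← neg_zero]
      apply Filter.Tendsto.neg
      refine squeeze_zero' (Filter.Eventually.of_forall fun t => (Real.exp_pos _).le)
        ((Filter.eventually_ge_atTop 0).mono fun t ht => exp_neg_mul_exp_le ha μ ht) ?_
      rw [← mul_zero (Real.exp ((1 - μ) ^ 2 / (2 * a)))]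
      exact (Real.tendsto_exp_neg_atTop_nhds_zero).const_mul _
    have := integral_Ioi_of_hasDerivAt_of_tendsto' hd (hi1.add hi2) hlim
    rw [integral_add hi1 hi2, integral_const_mul, integral_const_mul] at this
    rw [this]; simp
  have hsin : Real.sin ((μ - 1) * Real.pi) = - Real.sin (μ * Real.pi) := by
    rw [sub_mul, one_mul, Real.sin_sub_pi]
  have hray' : (a : ℂ) * ((∫ t in Ioi (0 : ℝ), Real.exp (-a * Real.exp t - (μ - 1) * t) : ℝ) : ℂ) +
      μ * ((∫ t in Ioi (0 : ℝ), Real.exp (-a * Real.exp t - μ * t) : ℝ) : ℂ) = (Real.exp (-a) : ℂ) := by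
    exact_mod_cast hray
  simp only [hankelContour, hsin]
  change (a : ℂ) * ((2 * Real.pi : ℂ)⁻¹ * (∫ y in (-Real.pi)..Real.pi, F (μ - 1) y) - _) =
    μ * ((2 * Real.pi : ℂ)⁻¹ * (∫ y in (-Real.pi)..Real.pi, F μ y) - _)
  rw [Complex.ofReal_mul, Complex.ofReal_mul, Complex.ofReal_div, Complex.ofReal_div,
    Complex.ofReal_neg]
  rw [Complex.ofReal_mul, Complex.ofReal_mul, ← hray'] at hseg
  generalize ((∫ t in Ioi (0 : ℝ), Real.exp (-a * Real.exp t - (μ - 1) * t) : ℝ) : ℂ) = R₁ at hseg ⊢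
  generalize ((∫ t in Ioi (0 : ℝ), Real.exp (-a * Real.exp t - μ * t) : ℝ) : ℂ) = R₂ at hseg ⊢
  field_simp
  push_cast at hseg ⊢
  linear_combination hseg

/-- Hankel's loop integral for the reciprocal Gamma function. -/
theorem hankelContour_eq {a : ℝ} (ha : 0 < a) (μ : ℝ) :
    hankelContour a μ = ((a ^ μ / Real.Gamma (μ + 1) : ℝ) : ℂ) := by
  -- Induction on an integer upper bound for `μ` carries the formula from `μ < 0` to all real `μ`,
  -- in place of analytic continuation.
  have key : ∀ N : ℕ, ∀ μ : ℝ, μ < N →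
      hankelContour a μ = ((a ^ μ / Real.Gamma (μ + 1) : ℝ) : ℂ) := by
    intro N
    induction N with
    | zero => exact fun μ hμ => hankelContour_of_neg ha (by simpa using hμ)
    | succ N ih =>
      intro μ hμ
      rcases eq_or_ne μ 0 with rfl | h0
      · simp [hankelContour_zero]
      have h1 := ih (μ - 1) (by push_cast at hμ; linarith)
      have h2 := hankelContour_recurrence ha μ
      have h0' : (μ : ℂ) ≠ 0 := by exact_mod_cast h0
      apply mul_left_cancel₀ h0'
      rw [← h2, h1]
      norm_cast
      rw [sub_add_cancel, Real.Gamma_add_one h0, Real.rpow_sub_one ha.ne']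
      field_simp
  obtain ⟨N, hN⟩ := exists_nat_gt μ
  exact key N μ hN

/-! ### Beta integrals and the power series of `J_ν` -/

theorem integrableOn_and_integral_beta {u v : ℝ} (hu : 0 < u) (hv : 0 < v) :
    IntegrableOn (fun x : ℝ => x ^ (u - 1) * (1 - x) ^ (v - 1)) (Ioc 0 1) ∧
    ∫ x in Ioc (0 : ℝ) 1, x ^ (u - 1) * (1 - x) ^ (v - 1) =
      Real.Gamma u * Real.Gamma v / Real.Gamma (u + v) := by
  have hc := Complex.betaIntegral_convergent (u := u) (v := v) (by simpa) (by simpa)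
  rw [intervalIntegrable_iff_integrableOn_Ioc_of_le zero_le_one] at hc
  have hcongr : ∀ x ∈ Ioc (0 : ℝ) 1, (x : ℂ) ^ ((u : ℂ) - 1) * (1 - (x : ℂ)) ^ ((v : ℂ) - 1) =
      ((x ^ (u - 1) * (1 - x) ^ (v - 1) : ℝ) : ℂ) := by
    intro x hx
    rw [Complex.ofReal_mul, Complex.ofReal_cpow hx.1.le, Complex.ofReal_cpow (by linarith [hx.2])]
    push_cast
    rfl
  have hI : IntegrableOn (fun x : ℝ => ((x ^ (u - 1) * (1 - x) ^ (v - 1) : ℝ) : ℂ)) (Ioc 0 1) :=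
    hc.congr_fun hcongr measurableSet_Ioc
  refine ⟨by unfold IntegrableOn; simpa using Integrable.re hI, ?_⟩
  have h1 := Complex.betaIntegral_eq_Gamma_mul_div u v (by simpa) (by simpa)
  rw [Complex.betaIntegral, intervalIntegral.integral_of_le zero_le_one,
    setIntegral_congr_fun measurableSet_Ioc hcongr, integral_complex_ofReal, ← Complex.ofReal_add,
    Complex.Gamma_ofReal, Complex.Gamma_ofReal, Complex.Gamma_ofReal] at h1
  exact_mod_cast h1

theorem integrableOn_and_integral_beta_sq {u v : ℝ} (hu : 0 < u) (hv : 0 < v) :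
    IntegrableOn (fun s : ℝ => s ^ (2 * u - 1) * (1 - s ^ 2) ^ (v - 1)) (Ioc 0 1) ∧
    ∫ s in Ioc (0 : ℝ) 1, s ^ (2 * u - 1) * (1 - s ^ 2) ^ (v - 1) =
      Real.Gamma u * Real.Gamma v / (2 * Real.Gamma (u + v)) := by
  obtain ⟨h1, h2⟩ := integrableOn_and_integral_beta hu hv
  set g : ℝ → ℝ := (Ioc (0 : ℝ) 1).indicator (fun x => x ^ (u - 1) * (1 - x) ^ (v - 1)) with hg
  have hsub : Ioc (0 : ℝ) 1 ⊆ Ioi 0 := fun x hx => hx.1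
  have hcomp : ∀ s ∈ Ioi (0 : ℝ), ((2 : ℝ) * s ^ ((2 : ℝ) - 1)) • g (s ^ (2 : ℝ)) =
      (Ioc (0 : ℝ) 1).indicator (fun s => 2 * (s ^ (2 * u - 1) * (1 - s ^ 2) ^ (v - 1))) s := by
    intro s hs
    have hs0 : (0 : ℝ) < s := hs
    rw [hg, Real.rpow_two]
    by_cases h : s ≤ 1
    · rw [indicator_of_mem (show s ∈ Ioc (0 : ℝ) 1 from ⟨hs0, h⟩),
        indicator_of_mem (show s ^ 2 ∈ Ioc (0 : ℝ) 1 from ⟨by positivity, by nlinarith⟩), smul_eq_mul]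
      have : s ^ (2 * u - 1) = s ^ ((2 : ℝ) - 1) * (s ^ 2) ^ (u - 1) := by
        rw [← Real.rpow_two, ← Real.rpow_mul hs0.le, ← Real.rpow_add hs0]
        congr 1; ring
      rw [this]; ring
    · rw [indicator_of_notMem (fun h' : s ^ 2 ∈ Ioc (0 : ℝ) 1 => by have := h'.2; apply h; nlinarith),
        indicator_of_notMem (fun h' => h h'.2), smul_zero]
  have hint : IntegrableOn g (Ioi 0) := by
    rw [hg]
    exact ((integrable_indicator_iff measurableSet_Ioc).2 h1).integrableOn
  constructor
  · rw [← integrableOn_Ioi_comp_rpow_iff g (p := 2) two_ne_zero] at hint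
    simp only [abs_two] at hint
    have h3 := hint.congr_fun hcomp measurableSet_Ioi
    have h4 := (h3.mono_set hsub).congr_fun (fun s hs => indicator_of_mem hs _) measurableSet_Ioc
    have h5 := h4.const_mul (1 / 2)
    refine IntegrableOn.congr_fun h5 (fun s _ => by ring) measurableSet_Ioc
  · have h3 := integral_comp_rpow_Ioi_of_pos (g := g) (p := 2) two_pos
    rw [setIntegral_congr_fun measurableSet_Ioi hcomp, hg, setIntegral_indicator measurableSet_Ioc,
      setIntegral_indicator measurableSet_Ioc, inter_eq_self_of_subset_right hsub, h2,
      integral_const_mul] at h3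
    have h4 : Real.Gamma u * Real.Gamma v / (2 * Real.Gamma (u + v)) =
      (Real.Gamma u * Real.Gamma v / Real.Gamma (u + v)) / 2 := by
      rw [mul_comm 2, div_mul_eq_div_div]
    rw [h4, ← h3, mul_div_cancel_left₀ _ two_ne_zero]

theorem Gamma_nat_add_half_eq (j : ℕ) :
    Real.Gamma (j + 1 / 2) = (2 * j).factorial * √Real.pi / (4 ^ j * j.factorial) := by
  have h := Real.Gamma_mul_Gamma_add_half (j + 1 / 2)
  rw [show (j : ℝ) + 1 / 2 + 1 / 2 = j + 1 by ring, Real.Gamma_nat_eq_factorial,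
    show 2 * ((j : ℝ) + 1 / 2) = (2 * j : ℕ) + 1 by push_cast; ring, Real.Gamma_nat_eq_factorial,
    show (1 : ℝ) - ((2 * j : ℕ) + 1) = -((2 * j : ℕ) : ℝ) by ring, Real.rpow_neg two_pos.le,
    Real.rpow_natCast, pow_mul] at h
  have h1 : (j.factorial : ℝ) ≠ 0 := by exact_mod_cast j.factorial_ne_zero
  field_simp
  have h2 : ((2 : ℝ) ^ 2) ^ j = 4 ^ j := by norm_num
  rw [h2] at h
  field_simp at h
  linarith

theorem integrableOn_poisson_weight {ν : ℝ} (hν : 0 < ν) :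
    IntegrableOn (fun s : ℝ => (1 - s ^ 2) ^ ((2 * ν - 1) / 2)) (Ioc 0 1) := by
  have := (integrableOn_and_integral_beta_sq (u := 1 / 2) (v := ν + 1 / 2) (by norm_num)
    (by linarith)).1
  refine this.congr_fun (fun s _ => ?_) measurableSet_Ioc
  simp only
  rw [show 2 * (1 / 2 : ℝ) - 1 = 0 by norm_num, Real.rpow_zero, one_mul]
  congr 1; ring

/-- The `k`-th term of the power series of the Bessel function of order `ν`. -/
noncomputable def besselTerm (ν x : ℝ) (k : ℕ) : ℝ :=
  (-1) ^ k * (x / 2) ^ (ν + 2 * k) / (k.factorial * Real.Gamma (ν + k + 1))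

theorem integral_poisson_symm {ν : ℝ} (hν : 0 < ν) (x : ℝ) :
    ∫ s in (-1 : ℝ)..1,
      Complex.exp (Complex.I * s * x) * (((1 - s ^ 2) ^ ((2 * ν - 1) / 2) : ℝ) : ℂ) =
    ((2 * ∫ s in Ioc (0 : ℝ) 1, Real.cos (x * s) * (1 - s ^ 2) ^ ((2 * ν - 1) / 2) : ℝ) : ℂ) := by
  set w : ℝ → ℝ := fun s => (1 - s ^ 2) ^ ((2 * ν - 1) / 2) with hw
  set f : ℝ → ℂ := fun s => Complex.exp (Complex.I * s * x) * (w s : ℂ) with hf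
  have hbd : ∀ c : ℝ, IntegrableOn (fun s : ℝ => Complex.exp (Complex.I * s * c) * (w s : ℂ))
      (Ioc 0 1) := by
    intro c
    refine Integrable.bdd_mul (c := 1) (integrableOn_poisson_weight hν).ofReal (by fun_prop) ?_
    refine Filter.Eventually.of_forall fun s => ?_
    rw [show Complex.I * s * c = ((s * c : ℝ) : ℂ) * Complex.I by push_cast; ring,
      Complex.norm_exp_ofReal_mul_I]
  have hneg : ∀ s, f (-s) = Complex.exp (Complex.I * s * (-x : ℝ)) * (w s : ℂ) := by
    intro s
    simp only [hf, hw, neg_sq]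
    congr 2; push_cast; ring
  have hi1 : IntervalIntegrable f volume 0 1 :=
    (intervalIntegrable_iff_integrableOn_Ioc_of_le zero_le_one).2 (hbd x)
  have hi2 : IntervalIntegrable (fun s => f (-s)) volume 0 1 := by
    simp only [hneg]
    exact (intervalIntegrable_iff_integrableOn_Ioc_of_le zero_le_one).2 (hbd (-x))
  have hi3 : IntervalIntegrable f volume (-1) 0 := by
    have := (hi2.comp_mul_left (c := -1)).symm
    simpa using this
  have h1 : ∫ s in (-1 : ℝ)..0, f s = ∫ s in (0 : ℝ)..1, f (-s) := by
    rw [intervalIntegral.integral_comp_neg]; simp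
  rw [← intervalIntegral.integral_add_adjacent_intervals hi3 hi1, h1,
    ← intervalIntegral.integral_add hi2 hi1, intervalIntegral.integral_of_le zero_le_one,
    ← integral_const_mul, ← integral_complex_ofReal]
  congr 1
  ext s
  rw [hneg]
  simp only [hf]
  push_cast
  rw [← add_mul]
  have : Complex.exp (Complex.I * s * -x) + Complex.exp (Complex.I * s * x) =
      2 * Complex.cos (x * s) := by
    rw [Complex.two_cos, add_comm]
    congr 2 <;> ring
  rw [this]; ring

/-- Expand the cosine in Poisson's integral, with the terms dominated by those of `cosh x` times the
weight. The moments of the weight are Beta integrals, and the half-integer Gamma values absorb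
`(2k)!`. -/
theorem hasSum_besselTerm {ν x : ℝ} (hν : 0 < ν) (hx : 0 < x) :
    HasSum (fun k => (besselTerm ν x k : ℂ)) (besselJ ν x) := by
  rw [besselJ, integral_poisson_symm hν, ← Complex.ofReal_mul]
  norm_cast
  set w : ℝ → ℝ := fun s => (1 - s ^ 2) ^ ((2 * ν - 1) / 2) with hw
  have hwi := integrableOn_poisson_weight hν
  have hw0 : ∀ s ∈ Ioc (0 : ℝ) 1, 0 ≤ w s := fun s hs =>
    Real.rpow_nonneg (by nlinarith [hs.1, hs.2]) _
  have key : HasSum (fun k : ℕ => ∫ s in Ioc (0 : ℝ) 1,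
      ((-1) ^ k * (x * s) ^ (2 * k) / ((2 * k).factorial : ℝ)) * w s)
      (∫ s in Ioc (0 : ℝ) 1, Real.cos (x * s) * w s) := by
    have hs := Real.hasSum_cosh x
    refine hasSum_integral_of_dominated_convergence
      (fun k s => x ^ (2 * k) / ((2 * k).factorial : ℝ) * w s) ?_ ?_ ?_ ?_ ?_
    · intro k
      exact (Continuous.aestronglyMeasurable (by fun_prop)).mul hwi.aestronglyMeasurable
    · intro k
      refine (ae_restrict_mem measurableSet_Ioc).mono fun s hs => ?_
      rw [norm_mul, Real.norm_eq_abs, Real.norm_eq_abs, abs_of_nonneg (hw0 s hs)]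
      refine mul_le_mul_of_nonneg_right ?_ (hw0 s hs)
      rw [abs_div, abs_mul, abs_pow, abs_neg, abs_one, one_pow, one_mul, Nat.abs_cast, abs_pow,
        abs_of_nonneg (mul_nonneg hx.le hs.1.le)]
      gcongr
      · exact mul_nonneg hx.le hs.1.le
      · exact mul_le_of_le_one_right hx.le hs.2
    · exact Filter.Eventually.of_forall fun s => (hs.mul_right (w s)).summable
    · simp only [fun s => (hs.mul_right (w s)).tsum_eq]
      exact hwi.const_mul _
    · exact Filter.Eventually.of_forall fun s => (Real.hasSum_cos (x * s)).mul_right (w s)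
  have hG : Real.Gamma (ν + 1 / 2) ≠ 0 := (Real.Gamma_pos_of_pos (by linarith)).ne'
  have := (key.mul_left 2).mul_left
    ((x / 2) ^ ν / (Real.Gamma (ν + 1 / 2) * Real.Gamma (1 / 2)))
  convert! this using 1
  ext k
  have hmom := (integrableOn_and_integral_beta_sq (u := k + 1 / 2) (v := ν + 1 / 2) (by positivity)
    (by linarith)).2
  have e1 : ∫ s in Ioc (0 : ℝ) 1, ((-1) ^ k * (x * s) ^ (2 * k) / ((2 * k).factorial : ℝ)) * w s =
      (-1) ^ k * x ^ (2 * k) / ((2 * k).factorial : ℝ) *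
        (Real.Gamma (k + 1 / 2) * Real.Gamma (ν + 1 / 2) /
          (2 * Real.Gamma (k + 1 / 2 + (ν + 1 / 2)))) := by
    rw [← hmom, ← integral_const_mul]
    refine setIntegral_congr_fun measurableSet_Ioc fun s hs => ?_
    simp only [hw]
    have e : s ^ (2 * ((k : ℝ) + 1 / 2) - 1) = s ^ (2 * k) := by
      rw [← Real.rpow_natCast]; congr 1; push_cast; ring
    rw [e, show ν + 1 / 2 - 1 = (2 * ν - 1) / 2 by ring]
    ring
  rw [e1, Gamma_nat_add_half_eq, besselTerm, Real.Gamma_one_half_eq,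
    show (k : ℝ) + 1 / 2 + (ν + 1 / 2) = ν + k + 1 by ring,
    Real.rpow_add (by positivity), show (2 * k : ℝ) = (2 * k : ℕ) by push_cast; ring,
    Real.rpow_natCast, div_pow x 2, pow_mul 2 2]
  have h1 : ((2 * k).factorial : ℝ) ≠ 0 := by exact_mod_cast (2 * k).factorial_ne_zero
  have h2 : (k.factorial : ℝ) ≠ 0 := by exact_mod_cast k.factorial_ne_zero
  have h3 : √Real.pi ≠ 0 := (Real.sqrt_pos.2 Real.pi_pos).ne'
  have h4 : Real.Gamma (ν + k + 1) ≠ 0 := (Real.Gamma_pos_of_pos (by positivity)).ne'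
  field_simp
  norm_num

/-! ### Schläfli's integral -/

theorem hasSum_exp_div_factorial (z : ℂ) :
    HasSum (fun k : ℕ => z ^ k / (k.factorial : ℂ)) (Complex.exp z) := by
  rw [Complex.exp_eq_exp_ℂ]
  exact NormedSpace.expSeries_div_hasSum_exp z

theorem Real.hasSum_exp_div_factorial (z : ℝ) :
    HasSum (fun k : ℕ => z ^ k / (k.factorial : ℝ)) (Real.exp z) := by
  rw [Real.exp_eq_exp_ℝ]
  exact NormedSpace.expSeries_div_hasSum_exp z

/-- Schläfli's integrand is `exp((x/2)(e^w - e^{-w}) - ν w)` at `w = iy`. Expanding only the factor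
`exp(-(x/2) e^{-w})` leaves in each term a Hankel contour integrand of order `ν + k`. -/
theorem hasSum_schlafli_segment (ν x : ℝ) :
    HasSum (fun k : ℕ => (-(x / 2 : ℂ)) ^ k / (k.factorial : ℂ) *
      ∫ y in (-Real.pi)..Real.pi, Complex.exp ((x / 2 : ℝ) * Complex.exp (y * Complex.I) -
        (ν + k : ℝ) * (y * Complex.I)))
      (∫ y in (-Real.pi)..Real.pi, Complex.exp (Complex.I * (x * Real.sin y - ν * y : ℝ))) := by
  have hc : ∀ k : ℕ, Continuous fun y : ℝ => Complex.exp ((x / 2 : ℝ) * Complex.exp (y * Complex.I) -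
        (ν + k : ℝ) * (y * Complex.I)) := fun k => by fun_prop
  simp only [← intervalIntegral.integral_const_mul]
  have hs := Real.hasSum_exp_div_factorial |x / 2|
  have hm := hs.mul_right (Real.exp |x / 2|)
  refine intervalIntegral.hasSum_integral_of_dominated_convergence
    (fun k _ => |x / 2| ^ k / (k.factorial : ℝ) * Real.exp |x / 2|) ?_ ?_ ?_ ?_ ?_
  · exact fun k => (continuous_const.mul (hc k)).aestronglyMeasurable
  · refine fun k => Filter.Eventually.of_forall fun y _ => ?_
    rw [norm_mul, norm_div, norm_pow, norm_neg]
    have e1 : ‖(x / 2 : ℂ)‖ = |x / 2| := by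
      rw [show (x / 2 : ℂ) = ((x / 2 : ℝ) : ℂ) by push_cast; rfl, Complex.norm_real,
        Real.norm_eq_abs]
    rw [e1, Complex.norm_natCast, Complex.norm_exp]
    gcongr
    have e2 : ((x / 2 : ℝ) * Complex.exp (y * Complex.I) - (ν + k : ℝ) * (y * Complex.I)).re =
        x / 2 * Real.cos y := by
      rw [Complex.sub_re, Complex.re_ofReal_mul, Complex.re_ofReal_mul, Complex.exp_ofReal_mul_I_re,
        Complex.re_ofReal_mul]
      simp
    rw [e2]
    refine (le_abs_self _).trans ?_
    rw [abs_mul]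
    exact mul_le_of_le_one_right (abs_nonneg _) (Real.abs_cos_le_one _)
  · exact Filter.Eventually.of_forall fun y _ => hm.summable
  · exact intervalIntegrable_const
  · refine Filter.Eventually.of_forall fun y _ => ?_
    have h := (hasSum_exp_div_factorial (-(x / 2 : ℂ) * Complex.exp (-(y * Complex.I)))).mul_right
      (Complex.exp ((x / 2 : ℝ) * Complex.exp (y * Complex.I) - ν * (y * Complex.I)))
    convert! h using 1
    · ext k
      rw [mul_pow, ← Complex.exp_nat_mul]
      have : Complex.exp ((x / 2 : ℝ) * Complex.exp (y * Complex.I) - (ν + k : ℝ) * (y * Complex.I))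
          = Complex.exp (k * -(y * Complex.I)) * Complex.exp
            ((x / 2 : ℝ) * Complex.exp (y * Complex.I) - ν * (y * Complex.I)) := by
        rw [← Complex.exp_add]; congr 1; push_cast; ring
      rw [this]; ring
    · rw [← Complex.exp_add]
      congr 1
      have := exp_sub_exp_eq_sin y
      push_cast at this ⊢
      linear_combination (-(x : ℂ) / 2) * this

/-- The same expansion on the rays `w = t ± iπ`, where `e^{-w} = -e^{-t}` makes every term positive.
-/
theorem hasSum_schlafli_ray (ν : ℝ) {x : ℝ} (hx : 0 < x) :
    HasSum (fun k : ℕ => (x / 2) ^ k / (k.factorial : ℝ) *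
      ∫ t in Ioi (0 : ℝ), Real.exp (-(x / 2) * Real.exp t - (ν + k) * t))
      (∫ t in Ioi (0 : ℝ), Real.exp (-(x * Real.sinh t) - ν * t)) := by
  simp only [← integral_const_mul]
  have hs := Real.hasSum_exp_div_factorial (x / 2)
  refine hasSum_integral_of_dominated_convergence
    (fun k t => (x / 2) ^ k / (k.factorial : ℝ) * Real.exp (-(x / 2) * Real.exp t - ν * t))
    ?_ ?_ ?_ ?_ ?_
  · exact fun k => Continuous.aestronglyMeasurable (by fun_prop)
  · refine fun k => (ae_restrict_mem measurableSet_Ioi).mono fun t ht => ?_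
    have ht0 : (0 : ℝ) < t := ht
    rw [Real.norm_eq_abs, abs_of_nonneg (by positivity)]
    gcongr
    linarith
  · exact Filter.Eventually.of_forall fun t => (hs.mul_right _).summable
  · simp only [fun t => (hs.mul_right (Real.exp (-(x / 2) * Real.exp t - ν * t))).tsum_eq]
    exact (integrableOn_exp_neg_mul_exp (half_pos hx) ν).const_mul _
  · refine Filter.Eventually.of_forall fun t => ?_
    have h := (Real.hasSum_exp_div_factorial (x / 2 * Real.exp (-t))).mul_right
      (Real.exp (-(x / 2) * Real.exp t - ν * t))
    convert! h using 1
    · ext k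
      rw [mul_pow, ← Real.exp_nat_mul]
      have : Real.exp (-(x / 2) * Real.exp t - (ν + k) * t) =
          Real.exp (k * -t) * Real.exp (-(x / 2) * Real.exp t - ν * t) := by
        rw [← Real.exp_add]; congr 1; ring
      rw [this]; ring
    · rw [← Real.exp_add, Real.sinh_eq]
      congr 1; ring

/-- Schläfli's integral representation of the Bessel function of real positive order. -/
theorem besselJ_eq_schlafli {ν x : ℝ} (hν : 0 < ν) (hx : 0 < x) :
    besselJ ν x = (2 * Real.pi : ℂ)⁻¹ * (∫ y in (-Real.pi)..Real.pi,
        Complex.exp (Complex.I * (x * Real.sin y - ν * y : ℝ))) -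
      ((Real.sin (ν * Real.pi) / Real.pi *
        ∫ t in Ioi (0 : ℝ), Real.exp (-(x * Real.sinh t) - ν * t) : ℝ) : ℂ) := by
  refine (hasSum_besselTerm hν hx).unique ?_
  have h1 := (hasSum_schlafli_segment ν x).mul_left (2 * Real.pi : ℂ)⁻¹
  have h2 := ((hasSum_schlafli_ray ν hx).mul_left (Real.sin (ν * Real.pi) / Real.pi))
  have h3 := h1.sub (Complex.hasSum_ofReal.2 h2)
  convert! h3 using 1
  ext k
  have hk := hankelContour_eq (half_pos hx) (ν + k)
  rw [hankelContour] at hk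
  -- This sign cancels the `(-1)^k` of the segment expansion, so segment and ray series combine term
  -- by term into `hankelContour (x / 2) (ν + k)`.
  have hsin : Real.sin ((ν + k) * Real.pi) = (-1) ^ k * Real.sin (ν * Real.pi) := by
    rw [add_mul, Real.sin_add_nat_mul_pi]
  rw [hsin] at hk
  have e : (besselTerm ν x k : ℂ) = (-(x / 2 : ℂ)) ^ k / (k.factorial : ℂ) *
      (((x / 2) ^ (ν + k) / Real.Gamma (ν + k + 1) : ℝ) : ℂ) := by
    rw [besselTerm, show ν + 2 * k = ν + k + k by ring, Real.rpow_add_natCast (half_pos hx).ne',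
      neg_pow (x / 2 : ℂ)]
    push_cast
    rw [div_mul_div_comm]
    ring
  have hsq : ((-1 : ℂ) ^ k) * (-1) ^ k = 1 := by rw [← mul_pow]; norm_num
  rw [e, ← hk, mul_sub, neg_pow (x / 2 : ℂ)]
  push_cast
  generalize ((∫ t in Ioi (0 : ℝ), Real.exp (-(x / 2) * Real.exp t - (ν + k) * t) : ℝ) : ℂ) = R
  linear_combination (-((x / 2 : ℂ) ^ k / (k.factorial : ℂ) *
    (Complex.sin (ν * Real.pi) / Real.pi * R))) * hsq

/-! ### Plancherel's theorem on the line -/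

open scoped FourierTransform SchwartzMap in
-- Both transforms define the same tempered distribution: the `L²` one by compatibility with
-- duality, the integral one by the multiplication formula. Testing against smooth compactly
-- supported functions identifies them.
theorem Lp_fourier_ae_eq_fourier {f : ℝ → ℂ} (h1 : Integrable f) (h2 : MemLp f 2) :
    ((𝓕 h2.toLp : Lp ℂ 2 (volume : Measure ℝ)) : ℝ → ℂ) =ᵐ[volume] 𝓕 f := by
  have hcont : Continuous (𝓕 f) := by
    have := VectorFourier.fourierIntegral_continuous (μ := volume) Real.continuous_fourierChar
      (L := innerₗ ℝ) continuous_inner h1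
    exact this
  refine ae_eq_of_integral_contDiff_smul_eq
    ((Lp.memLp _).locallyIntegrable (by norm_num)) hcont.locallyIntegrable fun g hg hgc => ?_
  set G : 𝓢(ℝ, ℂ) := HasCompactSupport.toSchwartzMap (f := fun x => (g x : ℂ))
    (hgc.comp_left (g := fun x : ℝ => (x : ℂ)) Complex.ofReal_zero)
    (Complex.ofRealCLM.contDiff.comp hg) with hG
  have hGx : ∀ x, G x = (g x : ℂ) := fun x => rfl
  have e1 := congrArg (fun T => T G) (Lp.fourier_toTemperedDistribution_eq h2.toLp)
  simp only [TemperedDistribution.fourier_apply, Lp.toTemperedDistribution_apply] at e1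
  have e2 : ∫ x, (𝓕 G) x • (h2.toLp : ℝ → ℂ) x = ∫ x, (𝓕 G) x • f x := by
    apply integral_congr_ae
    filter_upwards [h2.coeFn_toLp] with x hx
    rw [hx]
  have e3 : ∫ x, (𝓕 G) x • f x = ∫ x, G x • 𝓕 f x := by
    simpa using! VectorFourier.integral_fourierIntegral_smul_eq_flip (L := innerₗ ℝ)
      Real.continuous_fourierChar continuous_inner G.integrable h1
  rw [e2, e3] at e1
  simpa [hGx] using e1.symm

open scoped FourierTransform in
/-- Plancherel's theorem for integrable square-integrable functions on the line. -/
theorem lintegral_enorm_sq_fourier {f : ℝ → ℂ} (h1 : Integrable f) (h2 : MemLp f 2) :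
    ∫⁻ t, ‖𝓕 f t‖ₑ ^ 2 = ∫⁻ y, ‖f y‖ₑ ^ 2 := by
  have key : eLpNorm (𝓕 f) 2 volume = eLpNorm f 2 volume := by
    rw [← eLpNorm_congr_ae (Lp_fourier_ae_eq_fourier h1 h2), ← eLpNorm_congr_ae h2.coeFn_toLp]
    have := Lp.norm_fourier_eq h2.toLp
    rw [Lp.norm_def, Lp.norm_def,
      ENNReal.toReal_eq_toReal_iff' (Lp.eLpNorm_ne_top _) (Lp.eLpNorm_ne_top _)] at this
    exact this
  have hsq : ∀ g : ℝ → ℂ, eLpNorm g 2 volume ^ 2 = ∫⁻ y, ‖g y‖ₑ ^ 2 := fun g => by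
    have := eLpNorm_nnreal_pow_eq_lintegral (μ := volume) (f := g) (p := 2) two_ne_zero
    simpa using this
  rw [← hsq, ← hsq, key]

open scoped FourierTransform in
theorem lintegral_enorm_sq_integral_exp {f : ℝ → ℂ} (h1 : Integrable f) (h2 : MemLp f 2) {c : ℝ}
    (hc : |c| = 1) :
    ∫⁻ t : ℝ, ‖∫ y, Complex.exp (Complex.I * (c * t * y : ℝ)) * f y‖ₑ ^ 2 =
      ENNReal.ofReal (2 * Real.pi) * ∫⁻ y, ‖f y‖ₑ ^ 2 := by
  have hπ := Real.pi_pos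
  have e : ∀ t : ℝ, ∫ y, Complex.exp (Complex.I * (c * t * y : ℝ)) * f y =
      𝓕 f (-c / (2 * Real.pi) * t) := by
    intro t
    rw [Real.fourier_eq']
    congr 1
    ext y
    rw [smul_eq_mul]
    congr 2
    simp only [RCLike.inner_apply, conj_trivial]
    push_cast
    field_simp
  simp only [e]
  have hne : -c / (2 * Real.pi) ≠ 0 := by
    have : c ≠ 0 := by rintro rfl; simp at hc
    exact div_ne_zero (neg_ne_zero.2 this) (by positivity)
  have hcont : Continuous (𝓕 f) := by
    have := VectorFourier.fourierIntegral_continuous (μ := volume) Real.continuous_fourierChar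
      (L := innerₗ ℝ) continuous_inner h1
    exact this
  have hm := lintegral_map (μ := (volume : Measure ℝ)) (f := fun x => ‖𝓕 f x‖ₑ ^ 2)
    (g := fun t => -c / (2 * Real.pi) * t)
    (by have := hcont.measurable; fun_prop) (by fun_prop)
  have hmap := Real.map_volume_mul_left hne
  rw [← hm, hmap, lintegral_smul_measure, lintegral_enorm_sq_fourier h1 h2, smul_eq_mul]
  congr 2
  rw [inv_div, abs_div, abs_neg, hc, div_one, abs_of_pos (by positivity)]

/-! ### Pointwise bounds for `J_ν`, uniform in the order -/

theorem integral_schlafli_segment_eq (ν x : ℝ) :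
    ∫ y in (-Real.pi)..Real.pi, Complex.exp (Complex.I * (x * Real.sin y - ν * y : ℝ)) =
      (∫ t in 0..Real.pi, Complex.exp (Complex.I * (ν * t - x * Real.sin t : ℝ))) +
      starRingEnd ℂ (∫ t in 0..Real.pi, Complex.exp (Complex.I * (ν * t - x * Real.sin t : ℝ))) := by
  set g : ℝ → ℂ := fun y => Complex.exp (Complex.I * (x * Real.sin y - ν * y : ℝ)) with hg
  have hgc : Continuous g := by fun_prop
  rw [← intervalIntegral.integral_add_adjacent_intervals (b := 0)
    (hgc.intervalIntegrable _ _) (hgc.intervalIntegrable _ _)]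
  congr 1
  · have h := intervalIntegral.integral_comp_neg (a := 0) (b := Real.pi) g
    rw [neg_zero] at h
    rw [← h]
    congr 1
    ext t
    simp only [hg, Real.sin_neg]
    congr 3; ring
  · rw [intervalIntegral.integral_of_le Real.pi_pos.le,
      intervalIntegral.integral_of_le Real.pi_pos.le, ← integral_conj]
    congr 1
    ext t
    rw [← Complex.exp_conj, map_mul, Complex.conj_I, Complex.conj_ofReal]
    simp only [hg]
    congr 1; push_cast; ring

theorem integral_schlafli_ray_le {ν x : ℝ} (hν : 0 ≤ ν) (hx : 0 < x) :
    ∫ t in Ioi (0 : ℝ), Real.exp (-(x * Real.sinh t) - ν * t) ≤ 1 / x := by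
  have h1 : ∫ t in Ioi (0 : ℝ), Real.exp (-x * t) = 1 / x := by
    have := integral_exp_mul_Ioi (a := -x) (by linarith) 0
    rw [this]; simp
  rw [← h1]
  refine integral_mono_of_nonneg (Filter.Eventually.of_forall fun t => (Real.exp_pos _).le)
    (integrableOn_exp_mul_Ioi (by linarith) 0) ?_
  refine (ae_restrict_mem measurableSet_Ioi).mono fun t ht => ?_
  have ht0 : (0 : ℝ) < t := ht
  apply Real.exp_le_exp.2
  have := mul_le_mul_of_nonneg_left (Real.self_le_sinh_iff.2 ht0.le) hx.le
  nlinarith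

theorem norm_besselJ_le_phase {ν x : ℝ} (hν : 0 < ν) (hx : 0 < x) :
    ‖besselJ ν x‖ ≤
      ‖∫ t in 0..Real.pi, Complex.exp (Complex.I * (ν * t - x * Real.sin t : ℝ))‖ + 1 / x := by
  have hπ := Real.pi_gt_three
  rw [besselJ_eq_schlafli hν hx, integral_schlafli_segment_eq]
  set W := ∫ t in 0..Real.pi, Complex.exp (Complex.I * (ν * t - x * Real.sin t : ℝ))
  refine (norm_sub_le _ _).trans (add_le_add ?_ ?_)
  · rw [norm_mul, norm_inv]
    have h1 : ‖W + starRingEnd ℂ W‖ ≤ 2 * ‖W‖ := by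
      refine (norm_add_le _ _).trans ?_
      rw [RCLike.norm_conj]; linarith
    have h2 : ‖(2 * Real.pi : ℂ)‖ = 2 * Real.pi := by
      rw [norm_mul, Complex.norm_real, Real.norm_eq_abs, abs_of_pos (by linarith)]; simp
    rw [h2, inv_mul_le_iff₀ (by linarith)]
    nlinarith [norm_nonneg W]
  · have h0 : 0 ≤ ∫ t in Ioi (0 : ℝ), Real.exp (-(x * Real.sinh t) - ν * t) :=
      integral_nonneg fun t => (Real.exp_pos _).le
    rw [Complex.norm_real, Real.norm_eq_abs, abs_mul, abs_of_nonneg h0]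
    refine (mul_le_of_le_one_left h0 ?_).trans (integral_schlafli_ray_le hν.le hx)
    rw [abs_div, abs_of_pos (show 0 < Real.pi by linarith), div_le_one (by linarith)]
    linarith [Real.abs_sin_le_one (ν * Real.pi)]

theorem one_div_le_two_mul_rpow {x a : ℝ} (hx : 1 / 2 ≤ x) (ha0 : 0 ≤ a) (ha1 : a ≤ 1) :
    1 / x ≤ 2 * x ^ (-a) := by
  have hx0 : 0 < x := by linarith
  have h1 : 1 / x = x ^ (-(1 - a)) * x ^ (-a) := by
    rw [← Real.rpow_add hx0, show -(1 - a) + -a = -1 by ring, Real.rpow_neg_one, one_div]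
  rw [h1]
  refine mul_le_mul_of_nonneg_right ?_ (by positivity)
  have h2 : x ^ (-(1 - a)) ≤ (1 / 2) ^ (-(1 - a)) :=
    Real.rpow_le_rpow_of_nonpos (by norm_num) hx (by linarith)
  refine h2.trans ?_
  rw [one_div, Real.inv_rpow two_pos.le, ← Real.rpow_neg two_pos.le, neg_neg]
  calc (2 : ℝ) ^ (1 - a) ≤ 2 ^ (1 : ℝ) :=
        Real.rpow_le_rpow_of_exponent_le (by norm_num) (by linarith)
    _ = 2 := Real.rpow_one 2

/-- Landau's uniform bound for Bessel functions. -/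
theorem norm_besselJ_le_rpow_third {ν x : ℝ} (hν : 0 < ν) (hx : 1 / 2 ≤ x) :
    ‖besselJ ν x‖ ≤ 62 * x ^ (-(1 / 3) : ℝ) := by
  have h1 := norm_besselJ_le_phase hν (show 0 < x by linarith)
  have h2 := norm_integral_besselPhase_le_rpow_third hν.le hx
  have h3 := one_div_le_two_mul_rpow (a := 1 / 3) hx (by norm_num) (by norm_num)
  linarith

theorem norm_besselJ_le_rpow_half {ν x : ℝ} (hν : 0 < ν) (hx : 1 / 2 ≤ x) (hνx : 2 * ν ≤ x) :
    ‖besselJ ν x‖ ≤ 62 * x ^ (-(1 / 2) : ℝ) := by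
  have h1 := norm_besselJ_le_phase hν (show 0 < x by linarith)
  have h2 := norm_integral_besselPhase_le_rpow_half hν.le hx hνx
  have h3 := one_div_le_two_mul_rpow (a := 1 / 2) hx (by norm_num) (by norm_num)
  linarith

/-- On `(1, ∞)` the factor `x^{s-1}` is at least `1`. This keeps the small-argument bound for `J_ν`
independent of `ν`. -/
theorem exp_neg_one_le_Gamma {s : ℝ} (hs : 1 ≤ s) : Real.exp (-1) ≤ Real.Gamma s := by
  rw [Real.Gamma_eq_integral (by linarith)]
  have hi := Real.GammaIntegral_convergent (s := s) (by linarith)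
  have hsub : Ioi (1 : ℝ) ⊆ Ioi 0 := Ioi_subset_Ioi zero_le_one
  calc Real.exp (-1) = ∫ x in Ioi (1 : ℝ), Real.exp (-x) := (integral_exp_neg_Ioi 1).symm
    _ ≤ ∫ x in Ioi (1 : ℝ), Real.exp (-x) * x ^ (s - 1) := by
        refine setIntegral_mono_on (integrableOn_exp_neg_Ioi 1) (hi.mono_set hsub)
          measurableSet_Ioi fun x hx => ?_
        exact le_mul_of_one_le_right (Real.exp_pos _).le
          (Real.one_le_rpow (le_of_lt hx) (by linarith))
    _ ≤ ∫ x in Ioi (0 : ℝ), Real.exp (-x) * x ^ (s - 1) := by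
        refine setIntegral_mono_set hi ?_ hsub.eventuallyLE
        refine (ae_restrict_mem measurableSet_Ioi).mono fun x hx => ?_
        exact mul_nonneg (Real.exp_pos _).le (Real.rpow_nonneg (le_of_lt hx) _)

theorem norm_besselJ_le_div_Gamma {ν x : ℝ} (hν : 0 < ν) (hx : 0 < x) :
    ‖besselJ ν x‖ ≤ (x / 2) ^ ν / Real.Gamma (ν + 1) := by
  rw [besselJ, integral_poisson_symm hν, ← Complex.ofReal_mul, Complex.norm_real]
  have hwi := integrableOn_poisson_weight hν
  have hw : ∫ s in Ioc (0 : ℝ) 1, (1 - s ^ 2) ^ ((2 * ν - 1) / 2) =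
      Real.Gamma (1 / 2) * Real.Gamma (ν + 1 / 2) / (2 * Real.Gamma (ν + 1)) := by
    have := (integrableOn_and_integral_beta_sq (u := 1 / 2) (v := ν + 1 / 2) (by norm_num)
      (by linarith)).2
    rw [show (1 : ℝ) / 2 + (ν + 1 / 2) = ν + 1 by ring] at this
    rw [← this]
    refine setIntegral_congr_fun measurableSet_Ioc fun s _ => ?_
    rw [show 2 * (1 / 2 : ℝ) - 1 = 0 by norm_num, Real.rpow_zero, one_mul]
    congr 1; ring
  have hcos : ‖∫ s in Ioc (0 : ℝ) 1, Real.cos (x * s) * (1 - s ^ 2) ^ ((2 * ν - 1) / 2)‖ ≤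
      ∫ s in Ioc (0 : ℝ) 1, (1 - s ^ 2) ^ ((2 * ν - 1) / 2) := by
    refine norm_integral_le_of_norm_le hwi ?_
    refine (ae_restrict_mem measurableSet_Ioc).mono fun s hs => ?_
    have h0 : 0 ≤ (1 - s ^ 2) ^ ((2 * ν - 1) / 2) :=
      Real.rpow_nonneg (by nlinarith [hs.1, hs.2]) _
    rw [norm_mul, Real.norm_eq_abs, Real.norm_eq_abs, abs_of_nonneg h0]
    exact mul_le_of_le_one_left h0 (Real.abs_cos_le_one _)
  have hG1 : 0 < Real.Gamma (ν + 1 / 2) := Real.Gamma_pos_of_pos (by linarith)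
  have hG2 : 0 < Real.Gamma (1 / 2) := Real.Gamma_pos_of_pos (by norm_num)
  have hG3 : 0 < Real.Gamma (ν + 1) := Real.Gamma_pos_of_pos (by linarith)
  rw [norm_mul, norm_mul, Real.norm_two, Real.norm_eq_abs, abs_of_nonneg (by positivity)]
  rw [hw] at hcos
  calc _ ≤ (x / 2) ^ ν / (Real.Gamma (ν + 1 / 2) * Real.Gamma (1 / 2)) *
      (2 * (Real.Gamma (1 / 2) * Real.Gamma (ν + 1 / 2) / (2 * Real.Gamma (ν + 1)))) := by
        gcongr
    _ = _ := by field_simp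

theorem norm_besselJ_le_rpow_of_le_two {ν₀ ν x : ℝ} (hν₀ : 0 < ν₀) (hν : ν₀ ≤ ν) (hx : 0 < x)
    (hx2 : x ≤ 2) : ‖besselJ ν x‖ ≤ 3 * x ^ ν₀ := by
  have h1 := norm_besselJ_le_div_Gamma (hν₀.trans_le hν) hx
  have h2 := exp_neg_one_le_Gamma (s := ν + 1) (by linarith)
  -- Lowering the exponent from `ν` to `ν₀` requires a base at most `1`, which is why `x ≤ 2` is
  -- imposed.
  have h3 : (x / 2) ^ ν ≤ x ^ ν₀ :=
    (Real.rpow_le_rpow_of_exponent_ge (by linarith) (by linarith) hν).trans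
      (Real.rpow_le_rpow (by linarith) (by linarith) hν₀.le)
  have h4 : (1 : ℝ) / 3 ≤ Real.exp (-1) := by
    rw [Real.exp_neg, one_div]
    exact inv_anti₀ (Real.exp_pos 1) (by linarith [Real.exp_one_lt_d9])
  refine h1.trans ?_
  rw [div_le_iff₀ (Real.Gamma_pos_of_pos (by linarith))]
  have h5 : 0 ≤ x ^ ν₀ := by positivity
  nlinarith

/-! ### Mean-square bound over dyadic intervals -/

theorem integral_besselPhase_eq_integral_arcsin (ν x : ℝ) {θ : ℝ} (h0 : 0 ≤ θ)
    (h1 : θ < Real.pi / 2) :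
    ∫ t in 0..θ, Complex.exp (Complex.I * (ν * t - x * Real.sin t : ℝ)) =
      ∫ y in 0..Real.sin θ, Complex.exp (Complex.I * (-1 * x * y : ℝ)) *
        (Complex.exp (Complex.I * (ν * Real.arcsin y : ℝ)) * (((√(1 - y ^ 2))⁻¹ : ℝ) : ℂ)) := by
  have hsub : uIcc 0 θ ⊆ Icc (0 : ℝ) θ := by rw [uIcc_of_le h0]
  have hcos : ∀ t ∈ uIcc 0 θ, 0 < Real.cos t := fun t ht =>
    Real.cos_pos_of_mem_Ioo ⟨by linarith [(hsub ht).1, Real.pi_pos], by linarith [(hsub ht).2]⟩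
  have h := intervalIntegral.integral_deriv_smul_comp' (a := 0) (b := θ) (f := Real.sin)
    (f' := Real.cos) (g := fun y : ℝ => Complex.exp (Complex.I * (-1 * x * y : ℝ)) *
        (Complex.exp (Complex.I * (ν * Real.arcsin y : ℝ)) * (((√(1 - y ^ 2))⁻¹ : ℝ) : ℂ)))
    (fun t _ => Real.hasDerivAt_sin t) Real.continuous_cos.continuousOn (by
      have hc : ∀ y ∈ Real.sin '' uIcc 0 θ, √(1 - y ^ 2) ≠ 0 := by
        rintro _ ⟨t, ht, rfl⟩
        rw [← Real.abs_cos_eq_sqrt_one_sub_sin_sq]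
        exact (abs_pos.2 (hcos t ht).ne').ne'
      have := Real.continuous_arcsin
      refine ContinuousOn.mul (Continuous.continuousOn (by fun_prop)) (ContinuousOn.mul
        (Continuous.continuousOn (by fun_prop)) ?_)
      refine Complex.continuous_ofReal.comp_continuousOn (ContinuousOn.inv₀ ?_ hc)
      exact Continuous.continuousOn (by fun_prop))
  rw [Real.sin_zero] at h
  rw [← h]
  refine intervalIntegral.integral_congr fun t ht => ?_
  have ht' := hsub ht
  simp only [Function.comp]
  rw [← Real.abs_cos_eq_sqrt_one_sub_sin_sq, abs_of_pos (hcos t ht),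
    Real.arcsin_sin (by linarith [ht'.1, Real.pi_pos]) (by linarith [ht'.2])]
  have hne : (Real.cos t : ℂ) ≠ 0 := by exact_mod_cast (hcos t ht).ne'
  rw [Complex.real_smul, Complex.ofReal_inv, ← mul_assoc (Complex.exp _), ← Complex.exp_add,
    mul_comm (Complex.exp _), ← mul_assoc, mul_inv_cancel₀ hne, one_mul]
  congr 1; push_cast; ring

/-- After `y = sin t` the integral is the Fourier transform in `x` of a density of modulus at most
`1/cos θ` on an interval of length `sin θ ≤ 1`. The order enters only through `e^{iν arcsin y}`, so
Plancherel is uniform in `ν`. -/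
theorem lintegral_enorm_sq_besselPhase_le (ν : ℝ) {θ : ℝ} (h0 : 0 ≤ θ) (h1 : θ < Real.pi / 2) :
    ∫⁻ x : ℝ, ‖∫ t in 0..θ, Complex.exp (Complex.I * (ν * t - x * Real.sin t : ℝ))‖ₑ ^ 2 ≤
      ENNReal.ofReal (2 * Real.pi) * ENNReal.ofReal ((Real.cos θ)⁻¹ ^ 2) := by
  have hcθ : 0 < Real.cos θ := Real.cos_pos_of_mem_Ioo ⟨by linarith [Real.pi_pos], h1⟩
  have hs0 : 0 ≤ Real.sin θ := Real.sin_nonneg_of_nonneg_of_le_pi h0 (by linarith)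
  set h : ℝ → ℂ := fun y => Complex.exp (Complex.I * (ν * Real.arcsin y : ℝ)) *
    (((√(1 - y ^ 2))⁻¹ : ℝ) : ℂ) with hh
  set f := (Ioc 0 (Real.sin θ)).indicator h with hf
  have hbd : ∀ y ∈ Ioc 0 (Real.sin θ), ‖h y‖ ≤ (Real.cos θ)⁻¹ := by
    intro y hy
    simp only [hh]
    rw [norm_mul, mul_comm Complex.I, Complex.norm_exp_ofReal_mul_I, one_mul, Complex.norm_real,
      Real.norm_eq_abs, abs_of_nonneg (inv_nonneg.2 (Real.sqrt_nonneg _))]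
    refine inv_anti₀ hcθ ?_
    rw [← abs_of_pos hcθ, Real.abs_cos_eq_sqrt_one_sub_sin_sq]
    exact Real.sqrt_le_sqrt (by nlinarith [hy.1, hy.2])
  have hmeas : AEStronglyMeasurable f volume := by
    have : Measurable Real.arcsin := Real.continuous_arcsin.measurable
    refine (Measurable.indicator ?_ measurableSet_Ioc).aestronglyMeasurable
    fun_prop
  have hfb : ∀ y, ‖f y‖ ≤ (Ioc 0 (Real.sin θ)).indicator (fun _ => (Real.cos θ)⁻¹) y := by
    intro y
    by_cases hy : y ∈ Ioc 0 (Real.sin θ)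
    · rw [hf, indicator_of_mem hy, indicator_of_mem hy]; exact hbd y hy
    · rw [hf, indicator_of_notMem hy, indicator_of_notMem hy, norm_zero]
  have hmemb : ∀ p : ℝ≥0∞, MemLp ((Ioc 0 (Real.sin θ)).indicator
      (fun _ : ℝ => (Real.cos θ)⁻¹)) p volume := fun p =>
    memLp_indicator_const p measurableSet_Ioc _ (Or.inr measure_Ioc_lt_top.ne)
  have hmem : ∀ p : ℝ≥0∞, MemLp f p volume := fun p =>
    (hmemb p).of_le hmeas (Filter.Eventually.of_forall fun y =>
      (hfb y).trans (le_abs_self _))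
  have hP := lintegral_enorm_sq_integral_exp (memLp_one_iff_integrable.1 (hmem 1)) (hmem 2)
    (c := -1) (by norm_num)
  have e : ∀ x : ℝ, ∫ t in 0..θ, Complex.exp (Complex.I * (ν * t - x * Real.sin t : ℝ)) =
      ∫ y, Complex.exp (Complex.I * (-1 * x * y : ℝ)) * f y := by
    intro x
    rw [integral_besselPhase_eq_integral_arcsin ν x h0 h1, intervalIntegral.integral_of_le hs0,
      ← integral_indicator measurableSet_Ioc]
    congr 1
    ext y
    rw [hf, indicator_mul_right]
  simp only [e]
  rw [hP]
  refine mul_le_mul_right ?_ _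
  have hle : ∀ y, ‖f y‖ₑ ^ 2 ≤
      (Ioc 0 (Real.sin θ)).indicator (fun _ => ENNReal.ofReal ((Real.cos θ)⁻¹ ^ 2)) y := by
    intro y
    by_cases hy : y ∈ Ioc 0 (Real.sin θ)
    · rw [hf, indicator_of_mem hy, indicator_of_mem hy, ENNReal.ofReal_pow (by positivity)]
      gcongr
      rw [← ofReal_norm]
      exact ENNReal.ofReal_le_ofReal (hbd y hy)
    · rw [hf, indicator_of_notMem hy, indicator_of_notMem hy, enorm_zero]; simp
  refine (lintegral_mono hle).trans ?_
  rw [lintegral_indicator_const measurableSet_Ioc, Real.volume_Ioc, sub_zero]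
  exact mul_le_of_le_one_right zero_le (ENNReal.ofReal_le_one.2 (Real.sin_le_one θ))

/-- The mean square of `J_ν` over a dyadic interval is bounded uniformly in the order. -/
theorem lintegral_enorm_sq_besselJ_le {ν X : ℝ} (hν : 0 < ν) (hX : 1 / 2 ≤ X) :
    ∫⁻ x in Icc X (2 * X), ‖besselJ ν x‖ₑ ^ 2 ≤ ENNReal.ofReal 6000 := by
  have hX0 : 0 < X := by linarith
  have hvol : volume (Icc X (2 * X)) = ENNReal.ofReal X := by
    rw [Real.volume_Icc]; congr 1; ring
  -- If `2ν ≤ X`, the interval lies beyond the turning point and the `x^{-1/2}` bound suffices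
  -- (`3844 = 62²`). Otherwise the range of `t` is cut before `π/2`.
  rcases le_or_gt (2 * ν) X with hc | hc
  · have hb : ∀ x ∈ Icc X (2 * X), ‖besselJ ν x‖ₑ ^ 2 ≤ ENNReal.ofReal (3844 / X) := by
      intro x hx
      have hx0 : 0 < x := hX0.trans_le hx.1
      have h1 := norm_besselJ_le_rpow_half hν (hX.trans hx.1) (hc.trans hx.1)
      rw [← ofReal_norm, ← ENNReal.ofReal_pow (norm_nonneg _)]
      refine ENNReal.ofReal_le_ofReal ?_
      have h2 : (x ^ (-(1 / 2) : ℝ)) ^ 2 = 1 / x := by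
        rw [← Real.rpow_natCast, ← Real.rpow_mul hx0.le]
        norm_num [Real.rpow_neg_one]
      calc ‖besselJ ν x‖ ^ 2 ≤ (62 * x ^ (-(1 / 2) : ℝ)) ^ 2 := by gcongr
        _ = 3844 * (1 / x) := by rw [mul_pow, h2]; norm_num
        _ ≤ 3844 * (1 / X) := by
            have := one_div_le_one_div_of_le hX0 hx.1
            gcongr
        _ = 3844 / X := by ring
    refine (setLIntegral_mono' measurableSet_Icc hb).trans ?_
    rw [setLIntegral_const, hvol, ← ENNReal.ofReal_mul (by positivity)]
    refine ENNReal.ofReal_le_ofReal ?_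
    rw [div_mul_cancel₀ _ hX0.ne']; norm_num
  -- On `[θ, π]` one has `ν - x cos t ≥ X/2 - 2X/8 ≥ X/8`, so the first-derivative test gives
  -- `32/X`; the ray term raises this to `33/X`. The piece on `[0, θ]` is left to Plancherel.
  · set θ := Real.arccos (1 / 8) with hθ
    have hθ0 : 0 ≤ θ := Real.arccos_nonneg _
    have hθ1 : θ < Real.pi / 2 := Real.arccos_lt_pi_div_two.2 (by norm_num)
    have hcθ : Real.cos θ = 1 / 8 := Real.cos_arccos (by norm_num) (by norm_num)
    set W : ℝ → ℂ := fun x => ∫ t in 0..θ, Complex.exp (Complex.I * (ν * t - x * Real.sin t : ℝ))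
      with hW
    have hb : ∀ x ∈ Icc X (2 * X), ‖besselJ ν x‖ₑ ^ 2 ≤
        2 * ‖W x‖ₑ ^ 2 + ENNReal.ofReal (2 * (33 / X) ^ 2) := by
      intro x hx
      have hx0 : 0 < x := hX0.trans_le hx.1
      have h1 := norm_besselJ_le_phase hν hx0
      set f : ℝ → ℂ := fun t => Complex.exp (Complex.I * (ν * t - x * Real.sin t : ℝ)) with hf
      have hfc : Continuous f := by fun_prop
      rw [← intervalIntegral.integral_add_adjacent_intervals (b := θ)
        (hfc.intervalIntegrable _ _) (hfc.intervalIntegrable _ _)] at h1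
      have h2 : ‖∫ t in θ..Real.pi, f t‖ ≤ 4 / (X / 8) := by
        refine norm_integral_besselPhase_le_of_le_abs_deriv hx0.le (by linarith [Real.pi_pos]) hθ0
          le_rfl (by positivity) fun t ht => ?_
        have h3 : Real.cos t ≤ 1 / 8 := by
          rw [← hcθ]
          exact Real.cos_le_cos_of_nonneg_of_le_pi hθ0 ht.2 ht.1
        refine le_trans ?_ (le_abs_self _)
        nlinarith [hx.1, hx.2]
      have h3 : 1 / x ≤ 1 / X := one_div_le_one_div_of_le hX0 hx.1
      have h4 : 4 / (X / 8) = 32 * (1 / X) := by field_simp; norm_num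
      have h5 : ‖besselJ ν x‖ ≤ ‖W x‖ + 33 / X := by
        have := norm_add_le (∫ t in 0..θ, f t) (∫ t in θ..Real.pi, f t)
        rw [h4] at h2
        have h6 : 33 / X = 32 * (1 / X) + 1 / X := by ring
        rw [h6]
        change _ ≤ ‖∫ t in 0..θ, f t‖ + _
        linarith
      have h7 : ‖besselJ ν x‖ ^ 2 ≤ 2 * ‖W x‖ ^ 2 + 2 * (33 / X) ^ 2 := by
        have h8 : ‖besselJ ν x‖ ^ 2 ≤ (‖W x‖ + 33 / X) ^ 2 := by gcongr
        nlinarith [sq_nonneg (‖W x‖ - 33 / X)]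
      calc ‖besselJ ν x‖ₑ ^ 2 = ENNReal.ofReal (‖besselJ ν x‖ ^ 2) := by
            rw [← ofReal_norm, ENNReal.ofReal_pow (norm_nonneg _)]
        _ ≤ ENNReal.ofReal (2 * ‖W x‖ ^ 2 + 2 * (33 / X) ^ 2) := ENNReal.ofReal_le_ofReal h7
        _ = _ := by
            rw [ENNReal.ofReal_add (by positivity) (by positivity),
              ENNReal.ofReal_mul two_pos.le, ENNReal.ofReal_pow (norm_nonneg _), ofReal_norm,
              ENNReal.ofReal_ofNat]
    refine (setLIntegral_mono' measurableSet_Icc hb).trans ?_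
    rw [lintegral_add_right _ measurable_const, setLIntegral_const, hvol,
      lintegral_const_mul' _ _ (by norm_num), ← ENNReal.ofReal_mul (by positivity)]
    have hW2 : ∫⁻ x in Icc X (2 * X), ‖W x‖ₑ ^ 2 ≤
        ENNReal.ofReal (2 * Real.pi) * ENNReal.ofReal ((Real.cos θ)⁻¹ ^ 2) :=
      (setLIntegral_le_lintegral _ _).trans (lintegral_enorm_sq_besselPhase_le ν hθ0 hθ1)
    rw [← ENNReal.ofReal_mul (by positivity), hcθ] at hW2
    calc _ ≤ 2 * ENNReal.ofReal (2 * Real.pi * (1 / 8 : ℝ)⁻¹ ^ 2) +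
          ENNReal.ofReal (2 * (33 / X) ^ 2 * X) := by gcongr
      _ = ENNReal.ofReal (2 * (2 * Real.pi * (1 / 8 : ℝ)⁻¹ ^ 2) + 2 * (33 / X) ^ 2 * X) := by
          rw [ENNReal.ofReal_add (by positivity) (by positivity), ENNReal.ofReal_mul two_pos.le,
            ENNReal.ofReal_ofNat]
      _ ≤ ENNReal.ofReal 6000 := by
          refine ENNReal.ofReal_le_ofReal ?_
          have h1 : 2 * (33 / X) ^ 2 * X = 2178 * (1 / X) := by field_simp; norm_num
          have h2 : 1 / X ≤ 2 := by
            rw [div_le_iff₀ hX0]; linarith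
          rw [h1]
          have := Real.pi_lt_d2
          norm_num at h2 ⊢
          linarith

/-! ### Bessel bounds on a shell of radius `R` and frequencies in `[1,2]` -/

theorem measurable_besselJ (ν : ℝ) : Measurable (besselJ ν) := by
  have h : StronglyMeasurable fun r : ℝ => ∫ s in Ioc (-1 : ℝ) 1,
      Complex.exp (Complex.I * s * r) * (((1 - s ^ 2) ^ ((2 * ν - 1) / 2) : ℝ) : ℂ) := by
    refine StronglyMeasurable.integral_prod_right (f := fun r s : ℝ =>
      Complex.exp (Complex.I * s * r) * (((1 - s ^ 2) ^ ((2 * ν - 1) / 2) : ℝ) : ℂ)) ?_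
    apply Measurable.stronglyMeasurable
    simp only [Function.uncurry_def]
    fun_prop
  have h' := h.measurable
  have : besselJ ν = fun r => (((r / 2) ^ ν / (Real.Gamma (ν + 1 / 2) * Real.Gamma (1 / 2)) : ℝ) : ℂ) *
      ∫ s in Ioc (-1 : ℝ) 1,
        Complex.exp (Complex.I * s * r) * (((1 - s ^ 2) ^ ((2 * ν - 1) / 2) : ℝ) : ℂ) := by
    ext r
    rw [besselJ, intervalIntegral.integral_of_le (by norm_num)]
  rw [this]
  fun_prop

theorem setLIntegral_Icc_comp_mul_left {F : ℝ → ℝ≥0∞} (hF : Measurable F) {r : ℝ} (hr : 0 < r)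
    (a b : ℝ) : ∫⁻ x in Icc a b, F (r * x) =
      ENNReal.ofReal r⁻¹ * ∫⁻ x in Icc (r * a) (r * b), F x := by
  have hpre : (fun x => r * x) ⁻¹' Icc (r * a) (r * b) = Icc a b := by
    ext x
    simp [mul_le_mul_iff_right₀ hr]
  have h := setLIntegral_map (μ := (volume : Measure ℝ)) (s := Icc (r * a) (r * b))
    measurableSet_Icc hF (g := fun x => r * x) (by fun_prop)
  rw [hpre] at h
  rw [← h, Real.map_volume_mul_left hr.ne', Measure.restrict_smul, lintegral_smul_measure,
    smul_eq_mul, abs_of_pos (inv_pos.2 hr)]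

theorem min_rpow_eq_left {R a b : ℝ} (hR : 0 < R) (hR1 : R ≤ 1) (hab : b ≤ a) :
    min (R ^ a) (R ^ b) = R ^ a :=
  min_eq_left (Real.rpow_le_rpow_of_exponent_ge hR hR1 hab)

theorem min_rpow_eq_right {R a b : ℝ} (hR1 : 1 ≤ R) (hab : b ≤ a) :
    min (R ^ a) (R ^ b) = R ^ b :=
  min_eq_right (Real.rpow_le_rpow_of_exponent_le hR1 hab)

/-- The small-argument bound with `rρ ≤ 2R ≤ 2`. The constant is larger than this case needs, so
that it also serves for `R ≥ 1`, where `124 = 2 · 62`. -/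
theorem norm_besselJ_mul_le_of_le_one {ν₀ ν R r ρ : ℝ} (hν₀ : 0 < ν₀) (hν : ν₀ ≤ ν) (hR : 0 < R)
    (hR1 : R ≤ 1) (hr : r ∈ Icc (R / 2) R) (hρ : ρ ∈ Icc (1 : ℝ) 2) :
    ‖besselJ ν (r * ρ)‖ ≤ 124 * 2 ^ ν₀ * R ^ ν₀ := by
  have hr0 : 0 < r := (half_pos hR).trans_le hr.1
  have hρ0 : 0 < ρ := zero_lt_one.trans_le hρ.1
  have h1 : r * ρ ≤ 2 * R := by nlinarith [hr.2, hρ.2]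
  have h2 := norm_besselJ_le_rpow_of_le_two hν₀ hν (mul_pos hr0 hρ0) (h1.trans (by linarith))
  have h3 : (r * ρ) ^ ν₀ ≤ (2 * R) ^ ν₀ := Real.rpow_le_rpow (by positivity) h1 hν₀.le
  rw [Real.mul_rpow two_pos.le hR.le] at h3
  have h4 : 0 ≤ (2 : ℝ) ^ ν₀ * R ^ ν₀ := by positivity
  linarith

theorem norm_besselJ_mul_le {ν₀ ν R r ρ : ℝ} (hν₀ : 0 < ν₀) (hν : ν₀ ≤ ν) (hR : 0 < R)
    (hr : r ∈ Icc (R / 2) R) (hρ : ρ ∈ Icc (1 : ℝ) 2) :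
    ‖besselJ ν (r * ρ)‖ ≤ 124 * 2 ^ ν₀ * min (R ^ ν₀) (R ^ (-(1 / 3) : ℝ)) := by
  rcases le_total R 1 with hR1 | hR1
  · rw [min_rpow_eq_left hR hR1 (by linarith)]
    exact norm_besselJ_mul_le_of_le_one hν₀ hν hR hR1 hr hρ
  · rw [min_rpow_eq_right hR1 (by linarith)]
    have h1 : R / 2 ≤ r * ρ := by nlinarith [hr.1, hρ.1]
    have h2 := norm_besselJ_le_rpow_third (hν₀.trans_le hν) (show 1 / 2 ≤ r * ρ by linarith)
    have h3 : (r * ρ) ^ (-(1 / 3) : ℝ) ≤ (R / 2) ^ (-(1 / 3) : ℝ) :=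
      Real.rpow_le_rpow_of_nonpos (by positivity) h1 (by norm_num)
    have h4 : (R / 2) ^ (-(1 / 3) : ℝ) = R ^ (-(1 / 3) : ℝ) * 2 ^ (1 / 3 : ℝ) := by
      rw [Real.div_rpow hR.le two_pos.le, Real.rpow_neg two_pos.le, div_inv_eq_mul]
    have h5 : (2 : ℝ) ^ (1 / 3 : ℝ) ≤ 2 := by
      calc (2 : ℝ) ^ (1 / 3 : ℝ) ≤ 2 ^ (1 : ℝ) :=
            Real.rpow_le_rpow_of_exponent_le (by norm_num) (by norm_num)
        _ = 2 := Real.rpow_one 2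
    have h6 : (1 : ℝ) ≤ 2 ^ ν₀ := Real.one_le_rpow (by norm_num) hν₀.le
    have h7 : 0 < R ^ (-(1 / 3) : ℝ) := by positivity
    calc ‖besselJ ν (r * ρ)‖ ≤ 62 * (R ^ (-(1 / 3) : ℝ) * 2) := by
          refine h2.trans ?_
          rw [h4] at h3
          have := mul_le_mul_of_nonneg_left h5 h7.le
          linarith
      _ ≤ 124 * 2 ^ ν₀ * R ^ (-(1 / 3) : ℝ) := by nlinarith

theorem enorm_besselJ_sq_le_of_le_one {ν₀ ν R r ρ : ℝ} (hν₀ : 0 < ν₀) (hν : ν₀ ≤ ν) (hR : 0 < R)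
    (hR1 : R ≤ 1) (hr : r ∈ Icc (R / 2) R) (hρ : ρ ∈ Icc (1 : ℝ) 2) :
    ‖besselJ ν (r * ρ)‖ₑ ^ 2 ≤ ENNReal.ofReal ((124 * 2 ^ ν₀ * R ^ ν₀) ^ 2) := by
  rw [← ofReal_norm, ← ENNReal.ofReal_pow (norm_nonneg _)]
  have := norm_besselJ_mul_le_of_le_one hν₀ hν hR hR1 hr hρ
  exact ENNReal.ofReal_le_ofReal (by gcongr)

theorem le_sq_mul_two_rpow {ν₀ : ℝ} (hν₀ : 0 < ν₀) : 12000 ≤ (124 * (2 : ℝ) ^ ν₀) ^ 2 := by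
  have h6 : (1 : ℝ) ≤ 2 ^ ν₀ := Real.one_le_rpow (by norm_num) hν₀.le
  nlinarith

/-- For `R ≥ 1` the change of variables `x = rρ` costs the Jacobian `1/r ≤ 2/R`; this is the gain
`R^{-1/2}` in the `L² → L^∞` estimate. -/
theorem lintegral_enorm_sq_besselJ_frequency_le {ν₀ ν R r : ℝ} (hν₀ : 0 < ν₀) (hν : ν₀ ≤ ν)
    (hR : 0 < R) (hr : r ∈ Icc (R / 2) R) :
    ∫⁻ ρ in Icc (1 : ℝ) 2, ‖besselJ ν (r * ρ)‖ₑ ^ 2 ≤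
      ENNReal.ofReal ((124 * 2 ^ ν₀ * min (R ^ ν₀) (R ^ (-(1 / 2) : ℝ))) ^ 2) := by
  have hr0 : 0 < r := (half_pos hR).trans_le hr.1
  rcases le_total R 1 with hR1 | hR1
  · rw [min_rpow_eq_left hR hR1 (by linarith)]
    refine (setLIntegral_mono' measurableSet_Icc fun ρ hρ =>
      enorm_besselJ_sq_le_of_le_one hν₀ hν hR hR1 hr hρ).trans ?_
    rw [setLIntegral_const, Real.volume_Icc]
    norm_num
  · rw [min_rpow_eq_right hR1 (by linarith)]
    rw [setLIntegral_Icc_comp_mul_left ((measurable_besselJ ν).enorm.pow_const 2) hr0, mul_one,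
      mul_comm r 2]
    have h1 := lintegral_enorm_sq_besselJ_le (hν₀.trans_le hν) (X := r) (by linarith [hr.1])
    refine (mul_le_mul_right h1 _).trans ?_
    rw [← ENNReal.ofReal_mul (by positivity)]
    refine ENNReal.ofReal_le_ofReal ?_
    have h2 : (R ^ (-(1 / 2) : ℝ)) ^ 2 = R⁻¹ := by
      rw [← Real.rpow_natCast, ← Real.rpow_mul hR.le]
      norm_num [Real.rpow_neg_one]
    have h3 : r⁻¹ ≤ 2 * R⁻¹ := by
      rw [← div_eq_mul_inv, le_div_iff₀ hR, inv_mul_le_iff₀ hr0]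
      linarith [hr.1]
    rw [mul_pow, h2]
    have h4 := le_sq_mul_two_rpow hν₀
    have h5 : 0 < R⁻¹ := inv_pos.2 hR
    nlinarith

/-- Here the Jacobian is `1/ρ ≤ 1`, so there is no decay for `R ≥ 1`. For `R ≤ 1` the length `R/2`
of the shell supplies the extra `R^{1/2}`. -/
theorem lintegral_enorm_sq_besselJ_shell_le {ν₀ ν R ρ : ℝ} (hν₀ : 0 < ν₀) (hν : ν₀ ≤ ν)
    (hR : 0 < R) (hρ : ρ ∈ Icc (1 : ℝ) 2) :
    ∫⁻ r in Icc (R / 2) R, ‖besselJ ν (r * ρ)‖ₑ ^ 2 ≤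
      ENNReal.ofReal ((124 * 2 ^ ν₀ * min (R ^ (ν₀ + 1 / 2)) (R ^ (0 : ℝ))) ^ 2) := by
  have hρ0 : 0 < ρ := zero_lt_one.trans_le hρ.1
  rcases le_total R 1 with hR1 | hR1
  · rw [min_rpow_eq_left hR hR1 (by linarith)]
    refine (setLIntegral_mono' measurableSet_Icc fun r hr =>
      enorm_besselJ_sq_le_of_le_one hν₀ hν hR hR1 hr hρ).trans ?_
    rw [setLIntegral_const, Real.volume_Icc, ← ENNReal.ofReal_mul (by positivity)]
    refine ENNReal.ofReal_le_ofReal ?_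
    have h1 : R ^ (ν₀ + 1 / 2) = R ^ ν₀ * √R := by
      rw [Real.rpow_add hR, Real.sqrt_eq_rpow]
    rw [h1, ← mul_assoc, mul_pow _ (√R), Real.sq_sqrt hR.le]
    gcongr
    linarith
  · rw [min_rpow_eq_right hR1 (by linarith), Real.rpow_zero, mul_one]
    simp only [mul_comm _ ρ]
    rw [setLIntegral_Icc_comp_mul_left ((measurable_besselJ ν).enorm.pow_const 2) hρ0]
    have h1 := lintegral_enorm_sq_besselJ_le (hν₀.trans_le hν) (X := ρ * (R / 2))
      (by nlinarith [hρ.1])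
    rw [show 2 * (ρ * (R / 2)) = ρ * R by ring] at h1
    refine (mul_le_mul_right h1 _).trans ?_
    rw [← ENNReal.ofReal_mul (by positivity)]
    refine ENNReal.ofReal_le_ofReal ?_
    have h2 : ρ⁻¹ ≤ 1 := inv_le_one_of_one_le₀ hρ.1
    have h4 := le_sq_mul_two_rpow hν₀
    nlinarith

/-! ### The Hankel transform of a single mode -/

/-- The density whose Fourier transform in `t` is the Hankel transform of
`ρ⁻¹ e^{itρ} φ(ρ) b(ρ)` at `(t, r)`. -/
noncomputable def hankelDensity (n : ℕ) (ν : ℝ) (φ b : ℝ → ℂ) (r : ℝ) : ℝ → ℂ :=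
  (Icc 1 2).indicator fun ρ =>
    (((r * ρ) ^ (-(((n : ℝ) - 2) / 2)) * ρ ^ (n - 2) : ℝ) : ℂ) * besselJ ν (r * ρ) * (b ρ * φ ρ)

theorem hankelTransform_eq_integral_hankelDensity {n : ℕ} (hn : 2 ≤ n) (ν ε t r : ℝ) {φ : ℝ → ℂ}
    (hφ : tsupport φ ⊆ Icc 1 2) (b : ℝ → ℂ) :
    hankelTransform n ν (fun ρ => (ρ : ℂ)⁻¹ * Complex.exp (Complex.I * ε * t * ρ) * φ ρ * b ρ) r =
      ∫ ρ, Complex.exp (Complex.I * (ε * t * ρ : ℝ)) * hankelDensity n ν φ b r ρ := by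
  rw [hankelTransform, ← integral_indicator measurableSet_Ioi]
  congr 1
  ext ρ
  by_cases hρ : ρ ∈ Icc (1 : ℝ) 2
  · have hρ0 : 0 < ρ := zero_lt_one.trans_le hρ.1
    rw [indicator_of_mem (show ρ ∈ Ioi (0 : ℝ) from hρ0), hankelDensity, indicator_of_mem hρ]
    have h1 : ((ρ ^ (n - 1) : ℝ) : ℂ) = (ρ : ℂ) * ((ρ ^ (n - 2) : ℝ) : ℂ) := by
      rw [show n - 1 = n - 2 + 1 by omega]; push_cast; ring
    have hne : (ρ : ℂ) ≠ 0 := by exact_mod_cast hρ0.ne'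
    rw [h1, show Complex.I * ε * t * ρ = Complex.I * (ε * t * ρ : ℝ) by push_cast; ring,
      Complex.ofReal_mul ((r * ρ) ^ (-(((n : ℝ) - 2) / 2)))]
    generalize Complex.exp (Complex.I * (ε * t * ρ : ℝ)) = E
    field_simp
  · have h0 : φ ρ = 0 := image_eq_zero_of_notMem_tsupport fun h => hρ (hφ h)
    rw [hankelDensity, indicator_of_notMem hρ, mul_zero]
    by_cases hρ' : ρ ∈ Ioi (0 : ℝ)
    · rw [indicator_of_mem hρ', h0]; ring
    · rw [indicator_of_notMem hρ']

/-- With `α = (n-2)/2 ≥ 0` the left side is `r^{-α} ρ^α`, and each factor loses at most `2^α`. -/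
theorem rpow_mul_pow_le {n : ℕ} (hn : 2 ≤ n) {R r ρ : ℝ} (hR : 0 < R) (hr : r ∈ Icc (R / 2) R)
    (hρ : ρ ∈ Icc (1 : ℝ) 2) :
    (r * ρ) ^ (-(((n : ℝ) - 2) / 2)) * ρ ^ (n - 2) ≤
      4 ^ (((n : ℝ) - 2) / 2) * R ^ (-(((n : ℝ) - 2) / 2)) := by
  have hr0 : 0 < r := (half_pos hR).trans_le hr.1
  have hρ0 : 0 < ρ := zero_lt_one.trans_le hρ.1
  set α := ((n : ℝ) - 2) / 2 with hα
  have hα0 : 0 ≤ α := by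
    have : (2 : ℝ) ≤ n := by exact_mod_cast hn
    rw [hα]; linarith
  have h1 : ρ ^ (n - 2) = ρ ^ (2 * α) := by
    rw [← Real.rpow_natCast, Nat.cast_sub hn, hα]; congr 1; push_cast; ring
  have h2 : (r * ρ) ^ (-α) * ρ ^ (n - 2) = r ^ (-α) * ρ ^ α := by
    rw [h1, Real.mul_rpow hr0.le hρ0.le, mul_assoc, ← Real.rpow_add hρ0]
    congr 2; ring
  have h3 : r ^ (-α) ≤ 2 ^ α * R ^ (-α) := by
    refine (Real.rpow_le_rpow_of_nonpos (half_pos hR) hr.1 (by linarith)).trans (le_of_eq ?_)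
    rw [Real.div_rpow hR.le two_pos.le, Real.rpow_neg two_pos.le, div_inv_eq_mul, mul_comm]
  have h4 : ρ ^ α ≤ 2 ^ α := Real.rpow_le_rpow hρ0.le hρ.2 hα0
  have h5 : (4 : ℝ) ^ α = 2 ^ α * 2 ^ α := by
    rw [← Real.mul_rpow two_pos.le two_pos.le]; norm_num
  rw [h2, h5]
  calc r ^ (-α) * ρ ^ α ≤ (2 ^ α * R ^ (-α)) * 2 ^ α := by gcongr
    _ = _ := by ring

theorem enorm_hankelDensity_le {n : ℕ} (hn : 2 ≤ n) (ν : ℝ) (φ b : ℝ → ℂ) {R r ρ : ℝ} (hR : 0 < R)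
    (hr : r ∈ Icc (R / 2) R) (hρ : ρ ∈ Icc (1 : ℝ) 2) :
    ‖hankelDensity n ν φ b r ρ‖ₑ ≤
      ENNReal.ofReal (4 ^ (((n : ℝ) - 2) / 2) * R ^ (-(((n : ℝ) - 2) / 2))) *
        (‖besselJ ν (r * ρ)‖ₑ * ‖b ρ * φ ρ‖ₑ) := by
  have hr0 : 0 < r := (half_pos hR).trans_le hr.1
  have hρ0 : 0 < ρ := zero_lt_one.trans_le hρ.1
  rw [hankelDensity, indicator_of_mem hρ, enorm_mul, enorm_mul, mul_assoc]
  gcongr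
  rw [← ofReal_norm, Complex.norm_real, Real.norm_eq_abs, abs_of_nonneg (by positivity)]
  exact ENNReal.ofReal_le_ofReal (rpow_mul_pow_le hn hR hr hρ)

theorem lintegral_enorm_hankelDensity_rpow (n : ℕ) (ν : ℝ) (φ b : ℝ → ℂ) (r : ℝ) {p : ℕ}
    (hp : p ≠ 0) :
    ∫⁻ ρ, ‖hankelDensity n ν φ b r ρ‖ₑ ^ p =
      ∫⁻ ρ in Icc 1 2, ‖hankelDensity n ν φ b r ρ‖ₑ ^ p := by
  rw [← lintegral_indicator measurableSet_Icc]
  congr 1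
  ext ρ
  by_cases hρ : ρ ∈ Icc (1 : ℝ) 2
  · rw [indicator_of_mem hρ]
  · rw [indicator_of_notMem hρ, hankelDensity, indicator_of_notMem hρ, enorm_zero, zero_pow hp]

theorem lintegral_enorm_hankelDensity_sq_le {n : ℕ} (hn : 2 ≤ n) (ν : ℝ) (φ b : ℝ → ℂ) {R r : ℝ}
    (hR : 0 < R) (hr : r ∈ Icc (R / 2) R) :
    ∫⁻ ρ, ‖hankelDensity n ν φ b r ρ‖ₑ ^ 2 ≤
      ENNReal.ofReal ((4 ^ (((n : ℝ) - 2) / 2) * R ^ (-(((n : ℝ) - 2) / 2))) ^ 2) *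
        ∫⁻ ρ in Icc 1 2, ‖besselJ ν (r * ρ)‖ₑ ^ 2 * ‖b ρ * φ ρ‖ₑ ^ 2 := by
  rw [lintegral_enorm_hankelDensity_rpow n ν φ b r two_ne_zero,
    ← lintegral_const_mul' _ _ ENNReal.ofReal_ne_top]
  refine setLIntegral_mono' measurableSet_Icc fun ρ hρ => ?_
  rw [ENNReal.ofReal_pow (by positivity), ← mul_pow, ← mul_pow]
  gcongr
  exact enorm_hankelDensity_le hn ν φ b hR hr hρ

theorem enorm_hankelTransform_le {n : ℕ} (hn : 2 ≤ n) (ν : ℝ) (ε t : ℝ) {φ : ℝ → ℂ}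
    (hφ : tsupport φ ⊆ Icc 1 2) (b : ℝ → ℂ) {R r : ℝ} (hR : 0 < R) (hr : r ∈ Icc (R / 2) R) :
    ‖hankelTransform n ν
        (fun ρ => (ρ : ℂ)⁻¹ * Complex.exp (Complex.I * ε * t * ρ) * φ ρ * b ρ) r‖ₑ ≤
      ENNReal.ofReal (4 ^ (((n : ℝ) - 2) / 2) * R ^ (-(((n : ℝ) - 2) / 2))) *
        ∫⁻ ρ in Icc 1 2, ‖besselJ ν (r * ρ)‖ₑ * ‖b ρ * φ ρ‖ₑ := by
  rw [hankelTransform_eq_integral_hankelDensity hn ν ε t r hφ b]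
  refine (enorm_integral_le_lintegral_enorm _).trans ?_
  have h1 : ∀ ρ : ℝ, ‖Complex.exp (Complex.I * (ε * t * ρ : ℝ)) * hankelDensity n ν φ b r ρ‖ₑ =
      ‖hankelDensity n ν φ b r ρ‖ₑ ^ 1 := by
    intro ρ
    rw [enorm_mul, pow_one, ← ofReal_norm, mul_comm Complex.I, Complex.norm_exp_ofReal_mul_I,
      ENNReal.ofReal_one, one_mul]
  simp only [h1]
  rw [lintegral_enorm_hankelDensity_rpow n ν φ b r one_ne_zero,
    ← lintegral_const_mul' _ _ ENNReal.ofReal_ne_top]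
  refine setLIntegral_mono' measurableSet_Icc fun ρ hρ => ?_
  rw [pow_one]
  exact enorm_hankelDensity_le hn ν φ b hR hr hρ

theorem aemeasurable_mul_restrict_Icc {φ b : ℝ → ℂ} (hφ : Continuous φ)
    (hb : AEMeasurable b (volume.restrict (Ioi 0))) :
    AEMeasurable (fun ρ => b ρ * φ ρ) (volume.restrict (Icc 1 2)) :=
  (hb.mono_measure (Measure.restrict_mono
    (fun x (hx : x ∈ Icc (1 : ℝ) 2) => show x ∈ Ioi (0 : ℝ) from
      zero_lt_one.trans_le hx.1) le_rfl)).mul hφ.measurable.aemeasurable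

theorem memLp_hankelDensity {n : ℕ} (hn : 2 ≤ n) {ν₀ ν : ℝ} (hν₀ : 0 < ν₀) (hν : ν₀ ≤ ν)
    {φ b : ℝ → ℂ} (hφ : Continuous φ) (hb : AEMeasurable b (volume.restrict (Ioi 0))) {R r : ℝ}
    (hR : 0 < R) (hr : r ∈ Icc (R / 2) R)
    (hfin : ∫⁻ ρ in Icc 1 2, ‖b ρ * φ ρ‖ₑ ^ 2 ≠ ⊤) :
    MemLp (hankelDensity n ν φ b r) 2 volume := by
  have hmeas : AEStronglyMeasurable (hankelDensity n ν φ b r) volume := by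
    have := measurable_besselJ ν
    rw [hankelDensity, aestronglyMeasurable_indicator_iff measurableSet_Icc]
    refine AEMeasurable.aestronglyMeasurable (AEMeasurable.mul ?_
      (aemeasurable_mul_restrict_Icc hφ hb))
    exact Measurable.aemeasurable (by fun_prop)
  refine ⟨hmeas, ?_⟩
  have h2 := eLpNorm_nnreal_pow_eq_lintegral (μ := volume) (f := hankelDensity n ν φ b r) (p := 2)
    two_ne_zero
  have h3 : eLpNorm (hankelDensity n ν φ b r) 2 volume ^ 2 =
      ∫⁻ ρ, ‖hankelDensity n ν φ b r ρ‖ₑ ^ 2 := by simpa using h2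
  suffices h : ∫⁻ ρ, ‖hankelDensity n ν φ b r ρ‖ₑ ^ 2 < ⊤ by
    rw [← h3] at h
    by_contra h'
    rw [not_lt, top_le_iff] at h'
    simp [h'] at h
  refine (lintegral_enorm_hankelDensity_sq_le hn ν φ b hR hr).trans_lt ?_
  refine ENNReal.mul_lt_top ENNReal.ofReal_lt_top ?_
  set B := 124 * 2 ^ ν₀ * min (R ^ ν₀) (R ^ (-(1 / 3) : ℝ))
  calc ∫⁻ ρ in Icc 1 2, ‖besselJ ν (r * ρ)‖ₑ ^ 2 * ‖b ρ * φ ρ‖ₑ ^ 2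
      ≤ ∫⁻ ρ in Icc 1 2, ENNReal.ofReal B ^ 2 * ‖b ρ * φ ρ‖ₑ ^ 2 := by
        refine setLIntegral_mono' measurableSet_Icc fun ρ hρ => ?_
        gcongr
        rw [← ofReal_norm]
        exact ENNReal.ofReal_le_ofReal (norm_besselJ_mul_le hν₀ hν hR hr hρ)
    _ = ENNReal.ofReal B ^ 2 * ∫⁻ ρ in Icc 1 2, ‖b ρ * φ ρ‖ₑ ^ 2 :=
        lintegral_const_mul' _ _ (by finiteness)
    _ < ⊤ := ENNReal.mul_lt_top (by finiteness) hfin.lt_top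

theorem integrable_hankelDensity {n : ℕ} {ν : ℝ} {φ b : ℝ → ℂ} {r : ℝ}
    (h : MemLp (hankelDensity n ν φ b r) 2 volume) : Integrable (hankelDensity n ν φ b r) := by
  have h1 : MemLp (hankelDensity n ν φ b r) 1 (volume.restrict (Icc 1 2)) :=
    (h.restrict _).mono_exponent (by norm_num)
  have h2 : IntegrableOn (hankelDensity n ν φ b r) (Icc 1 2) := memLp_one_iff_integrable.1 h1
  rw [hankelDensity, integrable_indicator_iff measurableSet_Icc]
  exact h2.congr_fun (fun ρ hρ => by rw [hankelDensity, indicator_of_mem hρ]) measurableSet_Icc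

theorem lintegral_enorm_hankelTransform_sq_le {n : ℕ} (hn : 2 ≤ n) {ν₀ ν : ℝ} (hν₀ : 0 < ν₀)
    (hν : ν₀ ≤ ν) {ε : ℝ} (hε : |ε| = 1) {φ b : ℝ → ℂ} (hφc : Continuous φ)
    (hφ : tsupport φ ⊆ Icc 1 2) (hb : AEMeasurable b (volume.restrict (Ioi 0))) {R r : ℝ}
    (hR : 0 < R) (hr : r ∈ Icc (R / 2) R)
    (hfin : ∫⁻ ρ in Icc 1 2, ‖b ρ * φ ρ‖ₑ ^ 2 ≠ ⊤) :
    ∫⁻ t : ℝ, ‖hankelTransform n ν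
        (fun ρ => (ρ : ℂ)⁻¹ * Complex.exp (Complex.I * ε * t * ρ) * φ ρ * b ρ) r‖ₑ ^ 2 ≤
      ENNReal.ofReal (2 * Real.pi * (4 ^ (((n : ℝ) - 2) / 2) * R ^ (-(((n : ℝ) - 2) / 2))) ^ 2) *
        ∫⁻ ρ in Icc 1 2, ‖besselJ ν (r * ρ)‖ₑ ^ 2 * ‖b ρ * φ ρ‖ₑ ^ 2 := by
  have h2 := memLp_hankelDensity hn hν₀ hν hφc hb hR hr hfin
  simp only [hankelTransform_eq_integral_hankelDensity hn ν ε _ r hφ b]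
  rw [lintegral_enorm_sq_integral_exp (integrable_hankelDensity h2) h2 hε,
    ENNReal.ofReal_mul (p := 2 * Real.pi) (by positivity), mul_assoc]
  gcongr
  exact lintegral_enorm_hankelDensity_sq_le hn ν φ b hR hr

theorem pow_mul_sq_rpow_eq {n : ℕ} (hn : 2 ≤ n) {R : ℝ} (hR : 0 < R) :
    R ^ (n - 1) * (R ^ (-(((n : ℝ) - 2) / 2))) ^ 2 = R := by
  rw [← Real.rpow_natCast, ← Real.rpow_natCast, ← Real.rpow_mul hR.le, ← Real.rpow_add hR,
    Nat.cast_sub (by omega)]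
  nth_rewrite 2 [← Real.rpow_one R]
  congr 1
  push_cast
  ring

theorem min_rpow_mul_sqrt {R : ℝ} (hR : 0 < R) (ν₀ : ℝ) :
    √R * min (R ^ (ν₀ + 1 / 2)) (R ^ (0 : ℝ)) = min (R ^ (ν₀ + 1)) (R ^ (1 / 2 : ℝ)) := by
  rw [mul_min_of_nonneg _ _ (Real.sqrt_nonneg R), Real.sqrt_eq_rpow, ← Real.rpow_add hR,
    ← Real.rpow_add hR]
  congr 2 <;> ring

/-- Plancherel in `t` at fixed `r`, then Tonelli: at each frequency `ρ` only the mean square of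
`J_ν(rρ)` over the shell remains. The powers `R^{n-1}` and `R^{-(n-2)}` multiply to `R`, the square
of the extra `√R`. -/
theorem lintegral_shell_enorm_hankelTransform_sq_le {n : ℕ} (hn : 2 ≤ n) {ν₀ ν : ℝ} (hν₀ : 0 < ν₀)
    (hν : ν₀ ≤ ν) {ε : ℝ} (hε : |ε| = 1) {φ b : ℝ → ℂ} (hφc : Continuous φ)
    (hφ : tsupport φ ⊆ Icc 1 2) (hb : AEMeasurable b (volume.restrict (Ioi 0))) {R : ℝ}
    (hR : 0 < R) (hfin : ∫⁻ ρ in Icc 1 2, ‖b ρ * φ ρ‖ₑ ^ 2 ≠ ⊤) :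
    ∫⁻ r, (∫⁻ t : ℝ, ‖hankelTransform n ν
        (fun ρ => (ρ : ℂ)⁻¹ * Complex.exp (Complex.I * ε * t * ρ) * φ ρ * b ρ) r‖ₑ ^ 2)
        ∂shellMeasure n R ≤
      ENNReal.ofReal (2 * Real.pi * (4 ^ (((n : ℝ) - 2) / 2) * (124 * 2 ^ ν₀) *
        min (R ^ (ν₀ + 1)) (R ^ (1 / 2 : ℝ))) ^ 2) * ∫⁻ ρ in Icc 1 2, ‖b ρ * φ ρ‖ₑ ^ 2 := by
  set A : ℝ := 2 * Real.pi * (4 ^ (((n : ℝ) - 2) / 2) * R ^ (-(((n : ℝ) - 2) / 2))) ^ 2 with hA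
  have hA0 : 0 ≤ A := by have := Real.pi_pos; positivity
  set B : ℝ := (124 * 2 ^ ν₀ * min (R ^ (ν₀ + 1 / 2)) (R ^ (0 : ℝ))) ^ 2 with hB
  have hT := aemeasurable_mul_restrict_Icc hφc hb
  rw [shellMeasure]
  refine (lintegral_withDensity_le_lintegral_mul _
    (f := fun r : ℝ => ENNReal.ofReal (r ^ (n - 1))) (by fun_prop) _).trans ?_
  have hstep : ∀ r ∈ Icc (R / 2) R, ((fun r : ℝ => ENNReal.ofReal (r ^ (n - 1))) * fun r : ℝ =>
      ∫⁻ t : ℝ, ‖hankelTransform n ν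
        (fun ρ => (ρ : ℂ)⁻¹ * Complex.exp (Complex.I * ε * t * ρ) * φ ρ * b ρ) r‖ₑ ^ 2) r ≤
      ENNReal.ofReal (R ^ (n - 1)) * (ENNReal.ofReal A *
        ∫⁻ ρ in Icc 1 2, ‖besselJ ν (r * ρ)‖ₑ ^ 2 * ‖b ρ * φ ρ‖ₑ ^ 2) := by
    intro r hr
    have hr0 : 0 < r := (half_pos hR).trans_le hr.1
    simp only [Pi.mul_apply]
    gcongr
    · exact hr.2
    · exact lintegral_enorm_hankelTransform_sq_le hn hν₀ hν hε hφc hφ hb hR hr hfin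
  refine (setLIntegral_mono' measurableSet_Icc hstep).trans ?_
  rw [lintegral_const_mul' _ _ ENNReal.ofReal_ne_top,
    lintegral_const_mul' _ _ ENNReal.ofReal_ne_top, lintegral_lintegral_swap ?meas]
  case meas =>
    have := measurable_besselJ ν
    have h1 : Measurable fun z : ℝ × ℝ => ‖besselJ ν (z.1 * z.2)‖ₑ ^ 2 := by fun_prop
    have h2 : AEMeasurable (fun z : ℝ × ℝ => ‖b z.2 * φ z.2‖ₑ ^ 2)
        ((volume.restrict (Icc (R / 2) R)).prod (volume.restrict (Icc 1 2))) :=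
      (hT.comp_quasiMeasurePreserving Measure.quasiMeasurePreserving_snd).enorm.pow_const 2
    exact h1.aemeasurable.mul h2
  have hinner : ∀ ρ ∈ Icc (1 : ℝ) 2, ∫⁻ r in Icc (R / 2) R,
      ‖besselJ ν (r * ρ)‖ₑ ^ 2 * ‖b ρ * φ ρ‖ₑ ^ 2 ≤ ENNReal.ofReal B * ‖b ρ * φ ρ‖ₑ ^ 2 := by
    intro ρ hρ
    rw [lintegral_mul_const' _ _ (by finiteness)]
    gcongr
    exact lintegral_enorm_sq_besselJ_shell_le hν₀ hν hR hρ
  calc _ ≤ ENNReal.ofReal (R ^ (n - 1)) * (ENNReal.ofReal A *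
        ∫⁻ ρ in Icc 1 2, ENNReal.ofReal B * ‖b ρ * φ ρ‖ₑ ^ 2) := by
        exact mul_le_mul_right (mul_le_mul_right
          (setLIntegral_mono' measurableSet_Icc hinner) _) _
    _ = _ := by
        rw [lintegral_const_mul' _ _ ENNReal.ofReal_ne_top, ← mul_assoc, ← mul_assoc,
          ← ENNReal.ofReal_mul (by positivity), ← ENNReal.ofReal_mul (by positivity)]
        congr 2
        rw [← min_rpow_mul_sqrt hR ν₀, hA, hB]
        simp only [mul_pow]
        rw [Real.sq_sqrt hR.le]
        have := pow_mul_sq_rpow_eq hn hR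
        linear_combination (2 * Real.pi * (4 ^ (((n : ℝ) - 2) / 2)) ^ 2 * (124 ^ 2 * (2 ^ ν₀) ^ 2 *
          (min (R ^ (ν₀ + 1 / 2)) (R ^ (0 : ℝ))) ^ 2)) * this

/-! ### Integral inequalities for sums over modes -/

/-- The index set is not assumed countable, so only this direction is taken, as a supremum over
finite sums. -/
theorem tsum_lintegral_le_lintegral_tsum {ι α : Type*} [MeasurableSpace α] {μ : Measure α}
    {f : ι → α → ℝ≥0∞} (hf : ∀ i, AEMeasurable (f i) μ) :
    ∑' i, ∫⁻ x, f i x ∂μ ≤ ∫⁻ x, ∑' i, f i x ∂μ := by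
  rw [ENNReal.tsum_eq_iSup_sum]
  refine iSup_le fun s => ?_
  rw [← lintegral_finsetSum' s fun i _ => hf i]
  exact lintegral_mono fun x => ENNReal.sum_le_tsum s

theorem ENNReal.rpow_half_sq (a : ℝ≥0∞) : (a ^ (1 / 2 : ℝ)) ^ 2 = a := by
  rw [← ENNReal.rpow_natCast, ← ENNReal.rpow_mul]; norm_num

theorem ENNReal.sq_rpow_half (a : ℝ≥0∞) : (a ^ 2) ^ (1 / 2 : ℝ) = a := by
  rw [← ENNReal.rpow_natCast, ← ENNReal.rpow_mul]; norm_num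

/-- Minkowski's integral inequality for the `ℓ²` norm. -/
theorem tsum_lintegral_sq_le {ι α : Type*} [MeasurableSpace α] {μ : Measure α}
    {f : ι → α → ℝ≥0∞} (hf : ∀ i, AEMeasurable (f i) μ) :
    ∑' i, (∫⁻ x, f i x ∂μ) ^ 2 ≤ (∫⁻ x, (∑' i, f i x ^ 2) ^ (1 / 2 : ℝ) ∂μ) ^ 2 := by
  set B := ∫⁻ x, (∑' i, f i x ^ 2) ^ (1 / 2 : ℝ) ∂μ with hB
  rcases eq_or_ne B ⊤ with hBt | hBt
  · rw [hBt]; simp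
  have hle : ∀ i x, f i x ≤ (∑' i, f i x ^ 2) ^ (1 / 2 : ℝ) := fun i x => by
    rw [← ENNReal.sq_rpow_half (f i x)]
    exact ENNReal.rpow_le_rpow (ENNReal.le_tsum i) (by norm_num)
  have hA : ∀ i, ∫⁻ x, f i x ∂μ ≠ ⊤ := fun i =>
    ((lintegral_mono (hle i)).trans_lt hBt.lt_top).ne
  rw [ENNReal.tsum_eq_iSup_sum]
  refine iSup_le fun s => ?_
  set S := ∑ i ∈ s, (∫⁻ x, f i x ∂μ) ^ 2 with hS
  have hSt : S ≠ ⊤ := ENNReal.sum_ne_top.2 fun i _ => ENNReal.pow_ne_top (hA i)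
  -- Duality: pair `f i x` with the numbers `∫ f i`, apply Cauchy–Schwarz in `i`, then divide by the
  -- finite nonzero `S^{1/2}`.
  have h1 : S ≤ S ^ (1 / 2 : ℝ) * B := by
    calc S = ∑ i ∈ s, ∫⁻ x, (∫⁻ x, f i x ∂μ) * f i x ∂μ := by
          rw [hS]
          refine Finset.sum_congr rfl fun i _ => ?_
          rw [lintegral_const_mul' _ _ (hA i), sq]
      _ = ∫⁻ x, ∑ i ∈ s, (∫⁻ x, f i x ∂μ) * f i x ∂μ :=
          (lintegral_finsetSum' s fun i _ => (hf i).const_mul _).symm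
      _ ≤ ∫⁻ x, S ^ (1 / 2 : ℝ) * (∑' i, f i x ^ 2) ^ (1 / 2 : ℝ) ∂μ := by
          refine lintegral_mono fun x => ?_
          refine (ENNReal.inner_le_Lp_mul_Lq s _ _ Real.HolderConjugate.two_two).trans ?_
          simp only [ENNReal.rpow_two]
          gcongr
          exact ENNReal.sum_le_tsum s
      _ = S ^ (1 / 2 : ℝ) * B :=
          lintegral_const_mul' _ _ (ENNReal.rpow_ne_top_of_nonneg (by norm_num) hSt)
  rcases eq_or_ne S 0 with h0 | h0
  · rw [h0]; exact zero_le
  have h2 : S ^ (1 / 2 : ℝ) ≠ 0 := by simp [h0, hSt]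
  have h3 : S ^ (1 / 2 : ℝ) ≠ ⊤ := ENNReal.rpow_ne_top_of_nonneg (by norm_num) hSt
  have h4 : S ^ (1 / 2 : ℝ) ≤ B := by
    rw [← ENNReal.mul_le_mul_iff_right h2 h3]
    rwa [← sq, ENNReal.rpow_half_sq]
  rw [← ENNReal.rpow_half_sq S]
  gcongr

theorem lintegral_mul_sq_le {α : Type*} [MeasurableSpace α] {μ : Measure α} {f g : α → ℝ≥0∞}
    (hf : AEMeasurable f μ) (hg : AEMeasurable g μ) :
    (∫⁻ x, f x * g x ∂μ) ^ 2 ≤ (∫⁻ x, f x ^ 2 ∂μ) * ∫⁻ x, g x ^ 2 ∂μ := by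
  have h := ENNReal.lintegral_mul_le_Lp_mul_Lq μ Real.HolderConjugate.two_two hf hg
  simp only [ENNReal.rpow_two, Pi.mul_apply] at h
  calc _ ≤ ((∫⁻ x, f x ^ 2 ∂μ) ^ (1 / 2 : ℝ) * (∫⁻ x, g x ^ 2 ∂μ) ^ (1 / 2 : ℝ)) ^ 2 := by gcongr
    _ = _ := by rw [mul_pow, ENNReal.rpow_half_sq, ENNReal.rpow_half_sq]

/-! ### Square functions over a family of modes -/

/-- The Hankel transform of `ρ⁻¹ e^{iεtρ} φ(ρ) b(ρ)` at `z = (t, r)`. -/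
noncomputable def modulatedHankel (n : ℕ) (ν ε : ℝ) (φ b : ℝ → ℂ) (z : ℝ × ℝ) : ℂ :=
  hankelTransform n ν
    (fun ρ => (ρ : ℂ)⁻¹ * Complex.exp (Complex.I * ε * z.1 * ρ) * φ ρ * b ρ) z.2

theorem measurable_modulatedHankel (n : ℕ) (ν ε : ℝ) {φ b : ℝ → ℂ} (hφ : Continuous φ)
    (hb : AEMeasurable b (volume.restrict (Ioi 0))) : Measurable (modulatedHankel n ν ε φ b) := by
  have hJ := measurable_besselJ ν
  have hb' := hb.measurable_mk
  have hφ' := hφ.measurable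
  -- Each `b` is replaced by a measurable representative, which leaves every integral unchanged and
  -- yields joint measurability in `(t, r)`.
  have e : modulatedHankel n ν ε φ b = fun z : ℝ × ℝ => ∫ ρ in Ioi (0 : ℝ),
      (((z.2 * ρ) ^ (-(((n : ℝ) - 2) / 2)) : ℝ) : ℂ) * besselJ ν (z.2 * ρ) *
        ((ρ : ℂ)⁻¹ * Complex.exp (Complex.I * ε * z.1 * ρ) * φ ρ * hb.mk b ρ) *
          ((ρ ^ (n - 1) : ℝ) : ℂ) := by
    ext z
    rw [modulatedHankel, hankelTransform]
    refine integral_congr_ae ?_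
    filter_upwards [hb.ae_eq_mk] with ρ hρ
    rw [hρ]
  rw [e]
  refine StronglyMeasurable.measurable (StronglyMeasurable.integral_prod_right
    (f := fun (z : ℝ × ℝ) (ρ : ℝ) =>
      (((z.2 * ρ) ^ (-(((n : ℝ) - 2) / 2)) : ℝ) : ℂ) * besselJ ν (z.2 * ρ) *
        ((ρ : ℂ)⁻¹ * Complex.exp (Complex.I * ε * z.1 * ρ) * φ ρ * hb.mk b ρ) *
          ((ρ ^ (n - 1) : ℝ) : ℂ)) ?_)
  apply Measurable.stronglyMeasurable
  simp only [Function.uncurry_def]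
  fun_prop

theorem ae_mem_shell (n : ℕ) (R : ℝ) : ∀ᵐ z ∂(volume : Measure ℝ).prod (shellMeasure n R),
    z.2 ∈ Icc (R / 2) R := by
  have h : ∀ᵐ r ∂shellMeasure n R, r ∈ Icc (R / 2) R :=
    (withDensity_absolutelyContinuous _ _).ae_le (ae_restrict_mem measurableSet_Icc)
  have : SFinite (shellMeasure n R) := by rw [shellMeasure]; infer_instance
  exact Measure.quasiMeasurePreserving_snd.ae h

section Family

variable {ι : Type*} {n : ℕ} {ν₀ ε R : ℝ} {ν : ι → ℝ} {φ : ℝ → ℂ} {b : ι → ℝ → ℂ}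

theorem lintegral_tsum_enorm_modulatedHankel_sq_le (hn : 2 ≤ n) (hν₀ : 0 < ν₀)
    (hν : ∀ i, ν₀ ≤ ν i) (hε : |ε| = 1) (hφc : Continuous φ) (hφ : tsupport φ ⊆ Icc 1 2)
    (hb : ∀ i, AEMeasurable (b i) (volume.restrict (Ioi 0))) (hR : 0 < R)
    (hfin : ∫⁻ ρ in Icc 1 2, ∑' i, ‖b i ρ * φ ρ‖ₑ ^ 2 ≠ ⊤) :
    ∫⁻ z, ∑' i, ‖modulatedHankel n (ν i) ε φ (b i) z‖ₑ ^ 2 ∂volume.prod (shellMeasure n R) ≤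
      ENNReal.ofReal (2 * Real.pi * (4 ^ (((n : ℝ) - 2) / 2) * (124 * 2 ^ ν₀) *
        min (R ^ (ν₀ + 1)) (R ^ (1 / 2 : ℝ))) ^ 2) *
      ∫⁻ ρ in Icc 1 2, ∑' i, ‖b i ρ * φ ρ‖ₑ ^ 2 := by
  have : SFinite (shellMeasure n R) := by rw [shellMeasure]; infer_instance
  have hT : ∀ i, AEMeasurable (fun ρ => ‖b i ρ * φ ρ‖ₑ ^ 2) (volume.restrict (Icc 1 2)) :=
    fun i => (aemeasurable_mul_restrict_Icc hφc (hb i)).enorm.pow_const 2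
  have hsum := tsum_lintegral_le_lintegral_tsum hT
  have hsumt : ∑' i, ∫⁻ ρ in Icc 1 2, ‖b i ρ * φ ρ‖ₑ ^ 2 ≠ ⊤ := (hsum.trans_lt hfin.lt_top).ne
  -- Finite total energy leaves at most countably many modes with nonzero energy, and the others
  -- have vanishing transform on the shell. This permits exchanging sum and integral on the left.
  set S := Function.support fun i => ∫⁻ ρ in Icc 1 2, ‖b i ρ * φ ρ‖ₑ ^ 2 with hS
  have : Countable S := (Summable.countable_support_ennreal hsumt).to_subtype
  have hzero : ∀ z ∈ {z : ℝ × ℝ | z.2 ∈ Icc (R / 2) R}, ∀ i, i ∉ S →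
      modulatedHankel n (ν i) ε φ (b i) z = 0 := by
    intro z hz i hi
    have h0 : ∫⁻ ρ in Icc 1 2, ‖b i ρ * φ ρ‖ₑ ^ 2 = 0 := by simpa [hS] using hi
    have hle := enorm_hankelTransform_le hn (ν i) ε z.1 hφ (b i) hR hz
    have hJ : Measurable fun ρ => besselJ (ν i) (z.2 * ρ) :=
      (measurable_besselJ (ν i)).comp (by fun_prop)
    have hcs := lintegral_mul_sq_le (μ := volume.restrict (Icc (1 : ℝ) 2))
      (f := fun ρ => ‖besselJ (ν i) (z.2 * ρ)‖ₑ) (g := fun ρ => ‖b i ρ * φ ρ‖ₑ)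
      hJ.enorm.aemeasurable (aemeasurable_mul_restrict_Icc hφc (hb i)).enorm
    rw [h0, mul_zero, nonpos_iff_eq_zero, sq_eq_zero_iff] at hcs
    rw [hcs, mul_zero, nonpos_iff_eq_zero, enorm_eq_zero] at hle
    exact hle
  have hae : (fun z => ∑' i, ‖modulatedHankel n (ν i) ε φ (b i) z‖ₑ ^ 2)
      =ᵐ[volume.prod (shellMeasure n R)]
      fun z => ∑' i : S, ‖modulatedHankel n (ν i) ε φ (b i) z‖ₑ ^ 2 := by
    filter_upwards [ae_mem_shell n R] with z hz
    refine (tsum_subtype_eq_of_support_subset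
      (f := fun i => ‖modulatedHankel n (ν i) ε φ (b i) z‖ₑ ^ 2) fun i hi => ?_).symm
    by_contra h
    exact hi (by simp [hzero z hz i h])
  have hm : ∀ i, Measurable fun z => ‖modulatedHankel n (ν i) ε φ (b i) z‖ₑ ^ 2 := fun i =>
    (measurable_modulatedHankel n (ν i) ε hφc (hb i)).enorm.pow_const 2
  rw [lintegral_congr_ae hae, lintegral_tsum fun i : S => (hm i).aemeasurable]
  set D := ENNReal.ofReal (2 * Real.pi * (4 ^ (((n : ℝ) - 2) / 2) * (124 * 2 ^ ν₀) *
        min (R ^ (ν₀ + 1)) (R ^ (1 / 2 : ℝ))) ^ 2)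
  calc ∑' i : S, ∫⁻ z, ‖modulatedHankel n (ν i) ε φ (b i) z‖ₑ ^ 2 ∂volume.prod (shellMeasure n R)
      ≤ ∑' i : S, D * ∫⁻ ρ in Icc 1 2, ‖b i ρ * φ ρ‖ₑ ^ 2 := by
        refine ENNReal.tsum_le_tsum fun i => ?_
        rw [lintegral_prod_symm' _ (hm i)]
        exact lintegral_shell_enorm_hankelTransform_sq_le hn hν₀ (hν i) hε hφc hφ (hb i) hR
          (ENNReal.ne_top_of_tsum_ne_top hsumt i)
    _ = D * ∑' i : S, ∫⁻ ρ in Icc 1 2, ‖b i ρ * φ ρ‖ₑ ^ 2 := ENNReal.tsum_mul_left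
    _ ≤ D * ∑' i, ∫⁻ ρ in Icc 1 2, ‖b i ρ * φ ρ‖ₑ ^ 2 := by
        gcongr
        exact ENNReal.tsum_comp_le_tsum_of_injective Subtype.val_injective _
    _ ≤ _ := by gcongr

/-- The supremum of `|J_ν|` comes out of each integral uniformly in the mode, and Minkowski's
inequality moves the `ℓ²` norm inside. -/
theorem tsum_enorm_modulatedHankel_sq_le_lintegral (hn : 2 ≤ n) (hν₀ : 0 < ν₀)
    (hν : ∀ i, ν₀ ≤ ν i) (hφc : Continuous φ) (hφ : tsupport φ ⊆ Icc 1 2)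
    (hb : ∀ i, AEMeasurable (b i) (volume.restrict (Ioi 0))) (hR : 0 < R) {z : ℝ × ℝ}
    (hz : z.2 ∈ Icc (R / 2) R) :
    ∑' i, ‖modulatedHankel n (ν i) ε φ (b i) z‖ₑ ^ 2 ≤
      (ENNReal.ofReal (4 ^ (((n : ℝ) - 2) / 2) * (124 * 2 ^ ν₀) *
        min (R ^ (ν₀ - ((n : ℝ) - 2) / 2)) (R ^ (-(((n : ℝ) - 2) / 2) - 1 / 3))) *
      ∫⁻ ρ in Icc 1 2, (∑' i, ‖b i ρ * φ ρ‖ₑ ^ 2) ^ (1 / 2 : ℝ)) ^ 2 := by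
  have hmin : 4 ^ (((n : ℝ) - 2) / 2) * (124 * 2 ^ ν₀) *
      min (R ^ (ν₀ - ((n : ℝ) - 2) / 2)) (R ^ (-(((n : ℝ) - 2) / 2) - 1 / 3)) =
      4 ^ (((n : ℝ) - 2) / 2) * R ^ (-(((n : ℝ) - 2) / 2)) *
        (124 * 2 ^ ν₀ * min (R ^ ν₀) (R ^ (-(1 / 3) : ℝ))) := by
    rw [show ν₀ - ((n : ℝ) - 2) / 2 = -(((n : ℝ) - 2) / 2) + ν₀ by ring, sub_eq_add_neg _ (1 / 3 : ℝ),
      Real.rpow_add hR, Real.rpow_add hR, ← mul_min_of_nonneg _ _ (by positivity)]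
    ring
  set M := 4 ^ (((n : ℝ) - 2) / 2) * R ^ (-(((n : ℝ) - 2) / 2))
  set B := 124 * 2 ^ ν₀ * min (R ^ ν₀) (R ^ (-(1 / 3) : ℝ))
  have hB0 : 0 ≤ B := by positivity
  rw [hmin]
  have hi : ∀ i, ‖modulatedHankel n (ν i) ε φ (b i) z‖ₑ ^ 2 ≤
      ENNReal.ofReal (M * B) ^ 2 * (∫⁻ ρ in Icc 1 2, ‖b i ρ * φ ρ‖ₑ) ^ 2 := by
    intro i
    rw [← mul_pow]
    gcongr
    refine (enorm_hankelTransform_le hn (ν i) ε z.1 hφ (b i) hR hz).trans ?_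
    rw [ENNReal.ofReal_mul (p := M) (by positivity), mul_assoc,
      ← lintegral_const_mul' (ENNReal.ofReal B) _ ENNReal.ofReal_ne_top]
    have hle : ∫⁻ ρ in Icc 1 2, ‖besselJ (ν i) (z.2 * ρ)‖ₑ * ‖b i ρ * φ ρ‖ₑ ≤
        ∫⁻ ρ in Icc 1 2, ENNReal.ofReal B * ‖b i ρ * φ ρ‖ₑ := by
      refine setLIntegral_mono' measurableSet_Icc fun ρ hρ => ?_
      gcongr
      rw [← ofReal_norm]
      exact ENNReal.ofReal_le_ofReal (norm_besselJ_mul_le hν₀ (hν i) hR hz hρ)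
    exact mul_le_mul_right hle _
  refine (ENNReal.tsum_le_tsum hi).trans ?_
  rw [ENNReal.tsum_mul_left, mul_pow]
  gcongr
  exact tsum_lintegral_sq_le fun i => (aemeasurable_mul_restrict_Icc hφc (hb i)).enorm

/-- Cauchy–Schwarz in `ρ` puts `J_ν` in mean square rather than in supremum, improving `R^{-1/3}` to
`R^{-1/2}`; the squared norms then add over the modes. -/
theorem tsum_enorm_modulatedHankel_sq_le_lintegral_sq (hn : 2 ≤ n) (hν₀ : 0 < ν₀)
    (hν : ∀ i, ν₀ ≤ ν i) (hφc : Continuous φ) (hφ : tsupport φ ⊆ Icc 1 2)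
    (hb : ∀ i, AEMeasurable (b i) (volume.restrict (Ioi 0))) (hR : 0 < R) {z : ℝ × ℝ}
    (hz : z.2 ∈ Icc (R / 2) R) :
    ∑' i, ‖modulatedHankel n (ν i) ε φ (b i) z‖ₑ ^ 2 ≤
      (ENNReal.ofReal (4 ^ (((n : ℝ) - 2) / 2) * (124 * 2 ^ ν₀) *
        min (R ^ (ν₀ - ((n : ℝ) - 2) / 2)) (R ^ (-(((n : ℝ) - 1) / 2))))) ^ 2 *
      ∫⁻ ρ in Icc 1 2, ∑' i, ‖b i ρ * φ ρ‖ₑ ^ 2 := by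
  have hmin : 4 ^ (((n : ℝ) - 2) / 2) * (124 * 2 ^ ν₀) *
      min (R ^ (ν₀ - ((n : ℝ) - 2) / 2)) (R ^ (-(((n : ℝ) - 1) / 2))) =
      4 ^ (((n : ℝ) - 2) / 2) * R ^ (-(((n : ℝ) - 2) / 2)) *
        (124 * 2 ^ ν₀ * min (R ^ ν₀) (R ^ (-(1 / 2) : ℝ))) := by
    rw [show ν₀ - ((n : ℝ) - 2) / 2 = -(((n : ℝ) - 2) / 2) + ν₀ by ring,
      show -(((n : ℝ) - 1) / 2) = -(((n : ℝ) - 2) / 2) + -(1 / 2) by ring,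
      Real.rpow_add hR, Real.rpow_add hR, ← mul_min_of_nonneg _ _ (by positivity)]
    ring
  rw [hmin]
  set M := 4 ^ (((n : ℝ) - 2) / 2) * R ^ (-(((n : ℝ) - 2) / 2))
  set B := 124 * 2 ^ ν₀ * min (R ^ ν₀) (R ^ (-(1 / 2) : ℝ))
  have hB0 : 0 ≤ B := by positivity
  have hi : ∀ i, ‖modulatedHankel n (ν i) ε φ (b i) z‖ₑ ^ 2 ≤
      ENNReal.ofReal (M * B) ^ 2 * ∫⁻ ρ in Icc 1 2, ‖b i ρ * φ ρ‖ₑ ^ 2 := by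
    intro i
    have hJ : Measurable fun ρ => besselJ (ν i) (z.2 * ρ) :=
      (measurable_besselJ (ν i)).comp (by fun_prop)
    have hcs := lintegral_mul_sq_le (μ := volume.restrict (Icc (1 : ℝ) 2))
      (f := fun ρ => ‖besselJ (ν i) (z.2 * ρ)‖ₑ) (g := fun ρ => ‖b i ρ * φ ρ‖ₑ)
      hJ.enorm.aemeasurable (aemeasurable_mul_restrict_Icc hφc (hb i)).enorm
    calc _ ≤ (ENNReal.ofReal M * ∫⁻ ρ in Icc 1 2, ‖besselJ (ν i) (z.2 * ρ)‖ₑ * ‖b i ρ * φ ρ‖ₑ) ^ 2 :=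
          pow_le_pow_left' (enorm_hankelTransform_le hn (ν i) ε z.1 hφ (b i) hR hz) 2
      _ ≤ ENNReal.ofReal M ^ 2 * (ENNReal.ofReal (B ^ 2) *
            ∫⁻ ρ in Icc 1 2, ‖b i ρ * φ ρ‖ₑ ^ 2) := by
          rw [mul_pow]
          refine mul_le_mul_right (hcs.trans ?_) _
          gcongr
          exact lintegral_enorm_sq_besselJ_frequency_le hν₀ (hν i) hR hz
      _ = _ := by
          rw [← mul_assoc, ENNReal.ofReal_pow hB0, ← mul_pow, ← ENNReal.ofReal_mul (by positivity)]
  refine (ENNReal.tsum_le_tsum hi).trans ?_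
  rw [ENNReal.tsum_mul_left]
  gcongr
  exact tsum_lintegral_le_lintegral_tsum fun i =>
    (aemeasurable_mul_restrict_Icc hφc (hb i)).enorm.pow_const 2

end Family

/-! ### Assembly of the three estimates -/

theorem squareSum_eq_tsum_sigma {Λ : Set ℝ} {d : ℝ → ℕ} (a : (ν : Λ) → Fin (d ν) → ℂ) :
    squareSum a = (∑' p : (ν : Λ) × Fin (d ν), ‖a p.1 p.2‖ₑ ^ 2) ^ (1 / 2 : ℝ) := by
  rw [squareSum, ENNReal.tsum_sigma']

theorem squareSum_mul_enorm {Λ : Set ℝ} {d : ℝ → ℕ} (a : (ν : Λ) → Fin (d ν) → ℂ) (c : ℂ) :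
    squareSum a * ‖c‖ₑ = squareSum fun ν ℓ => a ν ℓ * c := by
  rw [squareSum_eq_tsum_sigma, squareSum_eq_tsum_sigma]
  simp only [enorm_mul, mul_pow]
  rw [ENNReal.tsum_mul_right, ENNReal.mul_rpow_of_nonneg _ _ (by norm_num), ENNReal.sq_rpow_half]

theorem eLpNorm_two_rpow_half {α : Type*} [MeasurableSpace α] (μ : Measure α) (F : α → ℝ≥0∞) :
    eLpNorm (fun x => F x ^ (1 / 2 : ℝ)) 2 μ = (∫⁻ x, F x ∂μ) ^ (1 / 2 : ℝ) := by
  rw [eLpNorm_eq_lintegral_rpow_enorm_toReal two_ne_zero (by norm_num)]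
  simp only [ENNReal.toReal_ofNat, enorm_eq_self, ENNReal.rpow_two, ENNReal.rpow_half_sq]

theorem le_of_mem_coneSpectrum {n : ℕ} {Y : Type*} [EMetricSpace Y] [MeasurableSpace Y]
    [BorelSpace Y] [ChartedSpace (EuclideanSpace ℝ (Fin (n - 1))) Y]
    [RiemannianBundle (fun y : Y => TangentSpace (𝓡 (n - 1)) y)] {V₀ : Y → ℝ} {ν₀ ν : ℝ}
    (hleast : IsLeast (coneEigenvalues n V₀) (ν₀ ^ 2)) (hν : ν ∈ coneSpectrum n V₀) : ν₀ ≤ ν :=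
  le_of_sq_le_sq (hleast.2 hν.2) hν.1.le

theorem proposition3p1 (n : ℕ) (hn : 2 ≤ n)
    {Y : Type*} [EMetricSpace Y] [MeasurableSpace Y] [BorelSpace Y] [CompactSpace Y]
    [ChartedSpace (EuclideanSpace ℝ (Fin (n - 1))) Y] [IsManifold (𝓡 (n - 1)) ∞ Y]
    [RiemannianBundle (fun y : Y => TangentSpace (𝓡 (n - 1)) y)]
    [IsContMDiffRiemannianBundle (𝓡 (n - 1)) ∞ (EuclideanSpace ℝ (Fin (n - 1)))
      (fun y : Y => TangentSpace (𝓡 (n - 1)) y)]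
    [IsRiemannianManifold (𝓡 (n - 1)) Y]
    (V₀ : Y → ℝ) (hV₀ : ContMDiff (𝓡 (n - 1)) 𝓘(ℝ, ℝ) ∞ V₀)
    (ν₀ : ℝ) (hν₀ : 0 < ν₀) (hleast : IsLeast (coneEigenvalues n V₀) (ν₀ ^ 2)) :
    ∃ C : ℝ, 0 < C ∧
      ∀ φ : ℝ → ℂ, ContDiff ℝ ∞ φ → tsupport φ ⊆ Icc 1 2 →
      ∀ b : (ν : coneSpectrum n V₀) → Fin (coneMultiplicity n V₀ ν) → ℝ → ℂ,
      (∀ ν ℓ, AEMeasurable (b ν ℓ) (volume.restrict (Ioi 0))) →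
      ∀ ε : ℝ, (ε = 1 ∨ ε = -1) →
      ∀ (k : ℤ) (R : ℝ), R = (2 : ℝ) ^ k →
        eLpNorm (hankelSquareFunction n ε φ b) 2 (volume.prod (shellMeasure n R)) ≤
          ENNReal.ofReal (C * min (R ^ (ν₀ + 1)) (R ^ (1 / 2 : ℝ))) *
            eLpNorm (fun ρ : ℝ => squareSum (fun ν ℓ => b ν ℓ ρ * φ ρ)) 2
              (volume.restrict (Icc 1 2)) ∧
        eLpNorm (hankelSquareFunction n ε φ b) ∞ (volume.prod (shellMeasure n R)) ≤
          ENNReal.ofReal (C * min (R ^ (ν₀ - ((n : ℝ) - 2) / 2))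
              (R ^ (-(((n : ℝ) - 2) / 2) - 1 / 3))) *
            eLpNorm (fun ρ : ℝ => squareSum (fun ν ℓ => b ν ℓ ρ) * ‖φ ρ‖ₑ) 1
              (volume.restrict (Icc 1 2)) ∧
        eLpNorm (hankelSquareFunction n ε φ b) ∞ (volume.prod (shellMeasure n R)) ≤
          ENNReal.ofReal (C * min (R ^ (ν₀ - ((n : ℝ) - 2) / 2))
              (R ^ (-(((n : ℝ) - 1) / 2)))) *
            eLpNorm (fun ρ : ℝ => squareSum (fun ν ℓ => b ν ℓ ρ) * ‖φ ρ‖ₑ) 2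
              (volume.restrict (Icc 1 2)) := by

  set K : ℝ := 4 ^ (((n : ℝ) - 2) / 2) * (124 * 2 ^ ν₀) with hK
  have hK0 : 0 < K := by positivity
  -- The factor `3` dominates the `√(2π)` from Plancherel; the two `L^∞` estimates hold already with
  -- `K`.
  refine ⟨3 * K, by positivity, ?_⟩
  intro φ hφs hφ b hb ε hε k R hRk
  have hR : 0 < R := by rw [hRk]; positivity
  have hε' : |ε| = 1 := by rcases hε with h | h <;> simp [h]
  have hφc : Continuous φ := hφs.continuous
  set N : ((ν : coneSpectrum n V₀) × Fin (coneMultiplicity n V₀ ν)) → ℝ := fun p => p.1 with hN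
  set β : ((ν : coneSpectrum n V₀) × Fin (coneMultiplicity n V₀ ν)) → ℝ → ℂ :=
    fun p => b p.1 p.2 with hβ
  have hν : ∀ p, ν₀ ≤ N p := fun p => le_of_mem_coneSpectrum hleast p.1.2
  have hβm : ∀ p, AEMeasurable (β p) (volume.restrict (Ioi 0)) := fun p => hb p.1 p.2
  have hG : hankelSquareFunction n ε φ b =
      fun z => (∑' p, ‖modulatedHankel n (N p) ε φ (β p) z‖ₑ ^ 2) ^ (1 / 2 : ℝ) := by
    ext z
    rw [hankelSquareFunction, squareSum_eq_tsum_sigma]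
    rfl
  have hQ : (fun ρ : ℝ => squareSum (fun ν ℓ => b ν ℓ ρ * φ ρ)) =
      fun ρ => (∑' p, ‖β p ρ * φ ρ‖ₑ ^ 2) ^ (1 / 2 : ℝ) := by
    ext ρ
    rw [squareSum_eq_tsum_sigma]
  simp only [squareSum_mul_enorm, hQ, hG]
  have hmono : ∀ m : ℝ, 0 ≤ m → ENNReal.ofReal (K * m) ≤ ENNReal.ofReal (3 * K * m) := fun m hm =>
    ENNReal.ofReal_le_ofReal (by nlinarith [mul_nonneg hK0.le hm])
  refine ⟨?_, ?_, ?_⟩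
  · rw [eLpNorm_two_rpow_half, eLpNorm_two_rpow_half]
    have hm0 : 0 < min (R ^ (ν₀ + 1)) (R ^ (1 / 2 : ℝ)) := by positivity
    -- Plancherel needs finite energy. If the energy is infinite, the right-hand side is `⊤` because
    -- its constant is positive.
    rcases eq_or_ne (∫⁻ ρ in Icc 1 2, ∑' p, ‖β p ρ * φ ρ‖ₑ ^ 2) ⊤ with hfin | hfin
    · rw [hfin, ENNReal.top_rpow_of_pos (by norm_num), ENNReal.mul_top]
      · exact le_top
      · simp only [ne_eq, ENNReal.ofReal_eq_zero, not_le]; positivity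
    · have h := lintegral_tsum_enorm_modulatedHankel_sq_le hn hν₀ hν hε' hφc hφ hβm hR hfin
      refine (ENNReal.rpow_le_rpow h (by norm_num)).trans ?_
      rw [ENNReal.mul_rpow_of_nonneg _ _ (by norm_num)]
      gcongr
      rw [← ENNReal.sq_rpow_half (ENNReal.ofReal (3 * K * min (R ^ (ν₀ + 1)) (R ^ (1 / 2 : ℝ)))),
        ← ENNReal.ofReal_pow (by positivity)]
      refine ENNReal.rpow_le_rpow (ENNReal.ofReal_le_ofReal ?_) (by norm_num)
      have hsq : 0 ≤ (K * min (R ^ (ν₀ + 1)) (R ^ (1 / 2 : ℝ))) ^ 2 := sq_nonneg _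
      rw [mul_assoc 3, mul_pow 3]
      nlinarith [Real.pi_lt_four]
  · rw [eLpNorm_exponent_top, eLpNorm_one_eq_lintegral_enorm]
    refine eLpNormEssSup_le_of_ae_enorm_bound ?_
    filter_upwards [ae_mem_shell n R] with z hz
    simp only [enorm_eq_self]
    have h := tsum_enorm_modulatedHankel_sq_le_lintegral (ε := ε) hn hν₀ hν hφc hφ hβm hR hz
    refine (ENNReal.rpow_le_rpow h (by norm_num)).trans ?_
    rw [ENNReal.sq_rpow_half]
    exact mul_le_mul_left (hmono _ (by positivity)) _
  · rw [eLpNorm_exponent_top, eLpNorm_two_rpow_half]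
    refine eLpNormEssSup_le_of_ae_enorm_bound ?_
    filter_upwards [ae_mem_shell n R] with z hz
    simp only [enorm_eq_self]
    have h := tsum_enorm_modulatedHankel_sq_le_lintegral_sq (ε := ε) hn hν₀ hν hφc hφ hβm hR hz
    refine (ENNReal.rpow_le_rpow h (by norm_num)).trans ?_
    rw [ENNReal.mul_rpow_of_nonneg _ _ (by norm_num), ENNReal.sq_rpow_half]
    exact mul_le_mul_left (hmono _ (by positivity)) _
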